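/- Let $n,s\ge 1$ and let $M^{2n+s}$ be a smooth (Hausdorff, second countable) manifold with a Riemannian metric $g$ and Levi-Civita connection $\nabla$. A \emph{weak metric $f$-structure} on $(M,g)$ consists of smooth $(1,1)$-tensors $f$ (of rank $2n$) and $Q$ (non-singular), smooth vector fields $\xi_i$ and smooth $1$-forms $\eta^i$ $(1\le i\le s)$ with $$f^2=-Q+\sum_i\eta^i\otimes\xi_i,\quad \eta^i(\xi_j)=\delta^i_j,\quad Q\,\xi_i=\xi_i,\quad g(fX,fY)=g(X,QY)-\sum_i\eta^i(X)\,\eta^i(Y).$$ Put $\Phi(X,Y)=g(X,fY)$ and $d\eta(X,Y)=\frac12\{X(\eta(Y))-Y(\eta(X))-\eta([X,Y])\}$. The structure is a \emph{weak almost $\mathcal S$-structure} if $\Phi=d\eta^1=\dots=d\eta^s$. Let $\mathcal D=\bigcap_i\ker\eta^i$, $\widetilde Q=Q-I$, $h_i=\frac12\,\pounds_{\xi_i}f$, $\widetilde h_i=Q^{-1}h_i$, and $R_{X,Y}=\nabla_X\nabla_Y-\nabla_Y\nabla_X-\nabla_{[X,Y]}$. \textbf{Proposition.} Let $M^{2n+s}(f,Q,\xi_i,\eta^i,g)$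 be a weak almost $\mathcal S$-manifold such that $R_{X,Y}\,\xi_i=0$ for all vector fields $X,Y$ and $\pounds_{\xi_i}Q=0$ $(1\le i\le s)$. Then $\widetilde h_1=\dots=\widetilde h_s=:\widetilde h$; at each point of $M$ the eigenvalues of $\widetilde h$ are exactly $0,+1,-1$; the corresponding eigenspaces form mutually orthogonal smooth distributions $\ker f$, $\mathcal D^+$, $\mathcal D^-$ of ranks $s,n,n$ respectively; and $\mathcal D=\mathcal D^+\oplus\mathcal D^-$, $TM=\ker f\oplus\mathcal D^+\oplus\mathcal D^-$, $f(\mathcal D^+)=\mathcal D^-$, $f(\mathcal D^-)=\mathcal D^+$. Moreover, if $(\nabla_XQ)Y=0$ for all vector fields $X,Y$ tangent to $\mathcal D$, then (i) for $X,Y,Z\in\mathcal D$, $$\begin{aligned}4(\nabla_{\widetilde hX}\Phi)(Y,Z)={}&(\nabla_{\widetilde QY}\Phi)(Z,\widetilde hX)+(\nabla_{\widetilde QY}\Phi)(\widetilde hZ,X)+(\nabla_{\widetilde QZ}\Phi)(\widetilde hX,Y)+(\nabla_{\widetilde QZ}\Phi)(X,\widetilde hY)\\&-3(\nabla_{\widetilde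 Q\widetilde hX}\Phi)(Y,Z)-(\nabla_Y\Phi)(\widetilde hZ,\widetilde QX)-(\nabla_Z\Phi)(\widetilde QX,\widetilde hY);\end{aligned}$$ (ii) $(\nabla_X\Phi)(Y,Z)=0$ for $X,Z\in\mathcal D^-$, $Y\in\mathcal D^+$; (iii) $(\nabla_X\Phi)(Y,Z)=0$ for $X,Y\in\mathcal D^+$, $Z\in\mathcal D$. -/

import Mathlib

open Bundle VectorField Module
open scoped Manifold ContDiff

set_option linter.unusedSectionVars false

noncomputable section

namespace WeakF

section Riemannian

variable {E : Type*} [NormedAddCommGroup E] [NormedSpace ℝ E] [FiniteDimensional ℝ E]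
  {H : Type*} [TopologicalSpace H] {I : ModelWithCorners ℝ E H}
  {M : Type*} [TopologicalSpace M] [ChartedSpace H M] [IsManifold I ∞ M]
  [RiemannianBundle (fun x : M ↦ TangentSpace I x)]
  [IsContMDiffRiemannianBundle I ∞ E (fun x : M ↦ TangentSpace I x)]

theorem mdiffAt_inner {X Y : Π x : M, TangentSpace I x} {x : M} (hX : MDiffAt (T% X) x)
    (hY : MDiffAt (T% Y) x) : MDiffAt (fun y ↦ inner ℝ (X y) (Y y)) x :=
  MDifferentiableAt.inner_bundle (F := E) (E := fun x : M ↦ TangentSpace I x)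
    (IB := I) (b := id) hX hY

/-- Right-hand side of the Koszul formula
`2 g(∇_X Y, Z) = X g(Y,Z) + Y g(Z,X) - Z g(X,Y) + g([X,Y],Z) - g([X,Z],Y) - g([Y,Z],X)`. -/
def koszul (Y X Z : Π x : M, TangentSpace I x) (x : M) : ℝ :=
  d% (fun y ↦ inner ℝ (Y y) (Z y)) x (X x) + d% (fun y ↦ inner ℝ (Z y) (X y)) x (Y x)
    - d% (fun y ↦ inner ℝ (X y) (Y y)) x (Z x)
    + inner ℝ (mlieBracket I X Y x) (Z x) - inner ℝ (mlieBracket I X Z x) (Y x)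
    - inner ℝ (mlieBracket I Y Z x) (X x)

theorem koszul_tensorial₁ {Y Z : Π x : M, TangentSpace I x} {x : M} (hY : MDiffAt (T% Y) x)
    (hZ : MDiffAt (T% Z) x) : TensorialAt I E (fun X ↦ koszul Y X Z x) x where
  smul {f X} hf hX := by
    simp [koszul, mlieBracket_smul_left hf hX, inner_add_left, inner_smul_left, inner_smul_right,
      mvfderiv_fun_mul hf (mdiffAt_inner hZ hX), mvfderiv_fun_mul hf (mdiffAt_inner hX hY)]
    rw [real_inner_comm (X x) (Z x)]
    ring
  add {X X'} hX hX' := by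
    simp [koszul, mlieBracket_add_left hX hX', inner_add_left, inner_add_right,
      mvfderiv_fun_add (mdiffAt_inner hZ hX) (mdiffAt_inner hZ hX'),
      mvfderiv_fun_add (mdiffAt_inner hX hY) (mdiffAt_inner hX' hY)]
    ring

theorem koszul_tensorial₂ {Y X : Π x : M, TangentSpace I x} {x : M} (hY : MDiffAt (T% Y) x)
    (hX : MDiffAt (T% X) x) : TensorialAt I E (fun Z ↦ koszul Y X Z x) x where
  smul {f Z} hf hZ := by
    simp [koszul, mlieBracket_smul_right hf hZ, inner_add_left, inner_smul_left, inner_smul_right,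
      mvfderiv_fun_mul hf (mdiffAt_inner hZ hX), mvfderiv_fun_mul hf (mdiffAt_inner hY hZ)]
    rw [real_inner_comm (Y x) (Z x)]
    ring
  add {Z Z'} hZ hZ' := by
    simp [koszul, mlieBracket_add_right hZ hZ', inner_add_left, inner_add_right,
      mvfderiv_fun_add (mdiffAt_inner hZ hX) (mdiffAt_inner hZ' hX),
      mvfderiv_fun_add (mdiffAt_inner hY hZ) (mdiffAt_inner hY hZ')]
    ring

open scoped Classical in
/-- The Levi-Civita connection: `g(∇_v Y, w)` is one half of the Koszul expression.
The value on a field `Y` that is not differentiable at `x` is irrelevant, and set to `0`. -/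
def leviCivitaForm (Y : Π x : M, TangentSpace I x) (x : M) :
    TangentSpace I x →L[ℝ] TangentSpace I x →L[ℝ] ℝ :=
  if hY : MDiffAt (T% Y) x then
    (1 / 2 : ℝ) • TensorialAt.mkHom₂ (fun X Z ↦ koszul Y X Z x) x
      (fun _ hZ ↦ koszul_tensorial₁ hY hZ) (fun _ hX ↦ koszul_tensorial₂ hY hX)
  else 0

theorem leviCivitaForm_apply {X Y Z : Π x : M, TangentSpace I x} {x : M}
    (hX : MDiffAt (T% X) x) (hY : MDiffAt (T% Y) x) (hZ : MDiffAt (T% Z) x) :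
    leviCivitaForm Y x (X x) (Z x) = 1 / 2 * koszul Y X Z x := by
  rw [leviCivitaForm, dif_pos hY]
  have := TensorialAt.mkHom₂_apply (I := I) (F := E) (F' := E) (Φ := fun X Z ↦ koszul Y X Z x)
      (fun _ hZ ↦ koszul_tensorial₁ hY hZ) (fun _ hX ↦ koszul_tensorial₂ hY hX) hX hZ
  simpa using this

/-- `∇ Y` at `x`, as the linear map `v ↦ ∇_v Y`, obtained from the Koszul form with the metric. -/
def leviCivitaAt (Y : Π x : M, TangentSpace I x) (x : M) :
    TangentSpace I x →L[ℝ] TangentSpace I x :=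
  haveI : FiniteDimensional ℝ (TangentSpace I x) :=
    VectorBundle.finiteDimensional ℝ E (fun x : M ↦ TangentSpace I x) x
  haveI : CompleteSpace (TangentSpace I x) := FiniteDimensional.complete ℝ _
  LinearMap.toContinuousLinearMap
    { toFun := fun v ↦ (InnerProductSpace.toDual ℝ (TangentSpace I x)).symm (leviCivitaForm Y x v)
      map_add' := fun v w ↦ by rw [map_add, map_add]
      map_smul' := fun c v ↦ by rw [map_smul, map_smulₛₗ]; rfl }

theorem inner_leviCivitaAt (Y : Π x : M, TangentSpace I x) (x : M) (v w : TangentSpace I x) :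
    inner ℝ (leviCivitaAt Y x v) w = leviCivitaForm Y x v w := by
  have : FiniteDimensional ℝ (TangentSpace I x) :=
    VectorBundle.finiteDimensional ℝ E (fun x : M ↦ TangentSpace I x) x
  have : CompleteSpace (TangentSpace I x) := FiniteDimensional.complete ℝ _
  exact InnerProductSpace.toDual_symm_apply

theorem leviCivitaAt_ext {x : M} {A B : TangentSpace I x →L[ℝ] TangentSpace I x}
    (h : ∀ X Z : Π x : M, TangentSpace I x, MDiffAt (T% X) x → MDiffAt (T% Z) x →
      inner ℝ (A (X x)) (Z x) = inner ℝ (B (X x)) (Z x)) : A = B := by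
  ext v
  refine ext_inner_right ℝ fun w ↦ ?_
  have := h (FiberBundle.extend E v) (FiberBundle.extend E w)
    (FiberBundle.mdifferentiableAt_extend ..) (FiberBundle.mdifferentiableAt_extend ..)
  simpa using this

/-- The Levi-Civita connection of the Riemannian metric of `M`. -/
def leviCivita : CovariantDerivative I E (fun x : M ↦ TangentSpace I x) where
  toFun := leviCivitaAt
  isCovariantDerivativeOnUniv :=
    { add := fun {Y Y' x} hY hY' _ ↦ by
        refine leviCivitaAt_ext fun X Z hX hZ ↦ ?_
        have hYY : MDiffAt (T% (Y + Y')) x := mdifferentiableAt_add_section hY hY'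
        simp only [inner_leviCivitaAt, add_apply, inner_add_left,
          leviCivitaForm_apply hX hY hZ, leviCivitaForm_apply hX hY' hZ,
          leviCivitaForm_apply hX hYY hZ]
        simp [koszul, mlieBracket_add_left hY hY', mlieBracket_add_right hY hY', inner_add_left,
          inner_add_right, mvfderiv_fun_add (mdiffAt_inner hY hZ) (mdiffAt_inner hY' hZ),
          mvfderiv_fun_add (mdiffAt_inner hX hY) (mdiffAt_inner hX hY')]
        ring
      leibniz := fun {Y f x} hY hf _ ↦ by
        refine leviCivitaAt_ext fun X Z hX hZ ↦ ?_
        have hfY : MDiffAt (T% (f • Y)) x := hf.smul_section hY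
        simp only [inner_leviCivitaAt, add_apply, inner_add_left,
          leviCivitaForm_apply hX hfY hZ, smul_apply, inner_smul_left,
          leviCivitaForm_apply hX hY hZ, ContinuousLinearMap.smulRight_apply]
        simp [koszul, mlieBracket_smul_left hf hY, mlieBracket_smul_right hf hY, inner_add_left,
          inner_smul_left, inner_smul_right,
          mvfderiv_fun_mul hf (mdiffAt_inner hY hZ), mvfderiv_fun_mul hf (mdiffAt_inner hX hY)]
        rw [real_inner_comm (X x) (Y x)]
        ring }

/-- The Levi-Civita connection satisfies the Koszul formula; it is thereby the torsion-free metric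
connection. -/
theorem two_mul_inner_leviCivita {X Y Z : Π x : M, TangentSpace I x} {x : M}
    (hX : MDiffAt (T% X) x) (hY : MDiffAt (T% Y) x) (hZ : MDiffAt (T% Z) x) :
    2 * inner ℝ (leviCivita Y x (X x)) (Z x) = koszul Y X Z x := by
  change 2 * inner ℝ (leviCivitaAt Y x (X x)) (Z x) = _
  rw [inner_leviCivitaAt, leviCivitaForm_apply hX hY hZ]
  ring

theorem leviCivita_torsion {X Y : Π x : M, TangentSpace I x} {x : M}
    (hX : MDiffAt (T% X) x) (hY : MDiffAt (T% Y) x) :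
    leviCivita Y x (X x) - leviCivita X x (Y x) = mlieBracket I X Y x := by
  refine ext_inner_right ℝ fun w ↦ ?_
  have hw := FiberBundle.mdifferentiableAt_extend (I := I) (F := E) (V := fun x : M ↦ TangentSpace I x) w
  have e : FiberBundle.extend E w x = w := by simp
  have h1 := two_mul_inner_leviCivita hX hY hw
  have h2 := two_mul_inner_leviCivita hY hX hw
  have h3 : (fun y ↦ inner ℝ (X y) (FiberBundle.extend E w y)) =
    (fun y ↦ inner ℝ (FiberBundle.extend E w y) (X y)) := funext fun y ↦ real_inner_comm _ _
  have h4 : (fun y ↦ inner ℝ (Y y) (FiberBundle.extend E w y)) =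
    (fun y ↦ inner ℝ (FiberBundle.extend E w y) (Y y)) := funext fun y ↦ real_inner_comm _ _
  have h5 : (fun y ↦ inner ℝ (X y) (Y y)) =
    (fun y ↦ inner ℝ (Y y) (X y)) := funext fun y ↦ real_inner_comm _ _
  simp only [koszul, h3, h4, h5, e] at h1 h2
  rw [mlieBracket_swap_apply (V := Y) (W := X), inner_neg_left] at h2
  rw [inner_sub_left]
  linarith

theorem leviCivita_metric {X Y Z : Π x : M, TangentSpace I x} {x : M}
    (hX : MDiffAt (T% X) x) (hY : MDiffAt (T% Y) x) (hZ : MDiffAt (T% Z) x) :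
    d% (fun y ↦ inner ℝ (Y y) (Z y)) x (X x) =
      inner ℝ (leviCivita Y x (X x)) (Z x) + inner ℝ (Y x) (leviCivita Z x (X x)) := by
  have h1 := two_mul_inner_leviCivita hX hY hZ
  have h2 := two_mul_inner_leviCivita hX hZ hY
  have h3 : (fun y ↦ inner ℝ (Z y) (Y y)) =
    (fun y ↦ inner ℝ (Y y) (Z y)) := funext fun y ↦ real_inner_comm _ _
  have h4 : (fun y ↦ inner ℝ (X y) (Y y)) =
    (fun y ↦ inner ℝ (Y y) (X y)) := funext fun y ↦ real_inner_comm _ _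
  have h5 : (fun y ↦ inner ℝ (X y) (Z y)) =
    (fun y ↦ inner ℝ (Z y) (X y)) := funext fun y ↦ real_inner_comm _ _
  simp only [koszul, h3, h4, h5] at h1 h2
  rw [mlieBracket_swap_apply (V := Z) (W := Y), inner_neg_left] at h2
  rw [real_inner_comm _ (Y x)]
  linarith

/-- `∇_X Y` for the Levi-Civita connection. -/
def nabla (X Y : Π x : M, TangentSpace I x) (x : M) : TangentSpace I x :=
  leviCivita Y x (X x)

/-- `R_{X,Y} Z = ∇_X ∇_Y Z - ∇_Y ∇_X Z - ∇_{[X,Y]} Z`. -/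
def curvature (X Y Z : Π x : M, TangentSpace I x) (x : M) : TangentSpace I x :=
  nabla X (nabla Y Z) x - nabla Y (nabla X Z) x - nabla (mlieBracket I X Y) Z x

/-- `(∇_X S) Y = ∇_X (S Y) - S (∇_X Y)` for a `(1,1)`-tensor `S`. -/
def nablaEndo (S : Π x : M, TangentSpace I x →L[ℝ] TangentSpace I x)
    (X Y : Π x : M, TangentSpace I x) (x : M) : TangentSpace I x :=
  nabla X (fun y ↦ S y (Y y)) x - S x (nabla X Y x)

/-- `(∇_X θ)(Y, Z) = X (θ(Y, Z)) - θ(∇_X Y, Z) - θ(Y, ∇_X Z)` for a `(0,2)`-tensor `θ`. -/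
def nablaForm (θ : Π x : M, TangentSpace I x → TangentSpace I x → ℝ)
    (X Y Z : Π x : M, TangentSpace I x) (x : M) : ℝ :=
  d% (fun y ↦ θ y (Y y) (Z y)) x (X x) - θ x (nabla X Y x) (Z x) - θ x (Y x) (nabla X Z x)

end Riemannian

section Manifold

variable {E : Type*} [NormedAddCommGroup E] [NormedSpace ℝ E]
  {H : Type*} [TopologicalSpace H] {I : ModelWithCorners ℝ E H}
  {M : Type*} [TopologicalSpace M] [ChartedSpace H M]

/-- Exterior derivative of a 1-form, normalized as
`dθ(X, Y) = (1/2) (X (θ(Y)) - Y (θ(X)) - θ([X, Y]))`. -/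
def extDeriv₁ (θ : Π x : M, TangentSpace I x →L[ℝ] ℝ) (X Y : Π x : M, TangentSpace I x) (x : M) :
    ℝ :=
  1 / 2 * (d% (fun y ↦ θ y (Y y)) x (X x) - d% (fun y ↦ θ y (X y)) x (Y x)
    - θ x (mlieBracket I X Y x))

/-- The field `x ↦ S_x(X_x)`. -/
def applyEndo (S : Π x : M, TangentSpace I x →L[ℝ] TangentSpace I x)
    (X : Π x : M, TangentSpace I x) (x : M) : TangentSpace I x := S x (X x)

/-- The eigenspaces of a `(1,1)`-tensor `S` for the constant eigenvalue `c`. -/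
def eigenDist (S : Π x : M, TangentSpace I x →L[ℝ] TangentSpace I x) (c : ℝ) (x : M) :
    Submodule ℝ (TangentSpace I x) :=
  Module.End.eigenspace (S x).toLinearMap c

/-- Lie derivative `(£_ξ S) X = [ξ, S X] - S [ξ, X]` of a `(1,1)`-tensor `S`. -/
def lieDerivEndo (ξ : Π x : M, TangentSpace I x)
    (S : Π x : M, TangentSpace I x →L[ℝ] TangentSpace I x)
    (X : Π x : M, TangentSpace I x) (x : M) : TangentSpace I x :=
  mlieBracket I ξ (fun y ↦ S y (X y)) x - S x (mlieBracket I ξ X x)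

variable [IsManifold I ∞ M]

/-- A smooth distribution of rank `k`: near each point it has a smooth frame of `k` fields. -/
def IsSmoothDistribution (k : ℕ) (D : Π x : M, Submodule ℝ (TangentSpace I x)) : Prop :=
  ∀ x : M, ∃ U : Set M, IsOpen U ∧ x ∈ U ∧ ∃ e : Fin k → Π y : M, TangentSpace I y,
    (∀ a, CMDiff[U] ∞ (T% (e a))) ∧
    ∀ y ∈ U, LinearIndependent ℝ (fun a ↦ e a y) ∧ Submodule.span ℝ (Set.range fun a ↦ e a y) = D y

/-- A `(1,1)`-tensor is smooth if it is a smooth section of the bundle `Hom(TM, TM)`. -/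
def SmoothEndo (S : Π x : M, TangentSpace I x →L[ℝ] TangentSpace I x) : Prop :=
  ContMDiff I (I.prod 𝓘(ℝ, E →L[ℝ] E)) ∞
    (fun x ↦ TotalSpace.mk' (E →L[ℝ] E) (E := fun x : M ↦ TangentSpace I x →L[ℝ] TangentSpace I x)
      x (S x))

/-- A 1-form is smooth if it is a smooth section of the cotangent bundle `Hom(TM, ℝ)`. -/
def SmoothForm₁ (θ : Π x : M, TangentSpace I x →L[ℝ] ℝ) : Prop :=
  ContMDiff I (I.prod 𝓘(ℝ, E →L[ℝ] ℝ)) ∞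
    (fun x ↦ TotalSpace.mk' (E →L[ℝ] ℝ) (E := fun x : M ↦ TangentSpace I x →L[ℝ] ℝ) x (θ x))

theorem SmoothEndo.mdiffAt_apply {S : Π x : M, TangentSpace I x →L[ℝ] TangentSpace I x}
    (hS : SmoothEndo S) {X : Π x : M, TangentSpace I x} {x : M} (hX : MDiffAt (T% X) x) :
    MDiffAt (T% (fun y ↦ S y (X y))) x := by
  have h := (hS x).mdifferentiableAt (by simp)
  exact MDifferentiableAt.clm_bundle_apply (IM := I) (IB := I) (F₁ := E) (F₂ := E)
    (E₁ := fun x : M ↦ TangentSpace I x)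
    (E₂ := fun x : M ↦ TangentSpace I x) (b := id) h hX

theorem lieDerivEndo_tensorial [FiniteDimensional ℝ E] (ξ : Π x : M, TangentSpace I x)
    {S : Π x : M, TangentSpace I x →L[ℝ] TangentSpace I x} (hS : SmoothEndo S) (x : M) :
    TensorialAt I E (fun X ↦ lieDerivEndo ξ S X x) x where
  smul {f X} hf hX := by
    have e : (fun y ↦ S y ((f • X) y)) = f • fun y ↦ S y (X y) := by ext y; simp
    simp only [lieDerivEndo, e, mlieBracket_smul_right hf hX,
      mlieBracket_smul_right hf (hS.mdiffAt_apply hX), map_add, map_smul]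
    module
  add {X X'} hX hX' := by
    have e : (fun y ↦ S y ((X + X') y)) = (fun y ↦ S y (X y)) + fun y ↦ S y (X' y) := by
      ext y; simp
    simp only [lieDerivEndo, e, mlieBracket_add_right hX hX',
      mlieBracket_add_right (hS.mdiffAt_apply hX) (hS.mdiffAt_apply hX'), map_add]
    abel

/-- `£_ξ S` as a `(1,1)`-tensor. -/
def lieDerivTensor [FiniteDimensional ℝ E] (ξ : Π x : M, TangentSpace I x)
    (S : Π x : M, TangentSpace I x →L[ℝ] TangentSpace I x) (hS : SmoothEndo S) (x : M) :
    TangentSpace I x →L[ℝ] TangentSpace I x :=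
  TensorialAt.mkHom (fun X ↦ lieDerivEndo ξ S X x) x (lieDerivEndo_tensorial ξ hS x)

variable (I M)

/-- A framed weak `f`-structure `(f, Q, ξ_i, η^i)` on a manifold of dimension `2n + s`. -/
structure FramedWeakFStructure (n s : ℕ) where
  f : Π x : M, TangentSpace I x →L[ℝ] TangentSpace I x
  Q : Π x : M, TangentSpace I x →L[ℝ] TangentSpace I x
  ξ : Fin s → Π x : M, TangentSpace I x
  η : Fin s → Π x : M, TangentSpace I x →L[ℝ] ℝ
  dim_eq : finrank ℝ E = 2 * n + s
  smooth_f : SmoothEndo f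
  smooth_Q : SmoothEndo Q
  smooth_ξ : ∀ i, CMDiff ∞ (T% (ξ i))
  smooth_η : ∀ i, SmoothForm₁ (η i)
  rank_f : ∀ x, finrank ℝ (f x).range = 2 * n
  nonsingular_Q : ∀ x, Function.Bijective (Q x)
  f_sq : ∀ x v, f x (f x v) = -Q x v + ∑ i, η i x v • ξ i x
  η_ξ : ∀ i j x, η i x (ξ j x) = if i = j then 1 else 0
  Q_ξ : ∀ i x, Q x (ξ i x) = ξ i x

namespace FramedWeakFStructure

variable {I M} {n s : ℕ} (𝒮 : FramedWeakFStructure I M n s)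

/-- The contact distribution `⋂ ker η^i`. -/
def contact (x : M) : Submodule ℝ (TangentSpace I x) := ⨅ i, (𝒮.η i x).ker

/-- The inverse tensor `Q⁻¹`. -/
def Qinv (x : M) : TangentSpace I x →L[ℝ] TangentSpace I x := (𝒮.Q x).inverse

/-- `Q̃ = Q - I`. -/
def Qt (x : M) : TangentSpace I x →L[ℝ] TangentSpace I x :=
  𝒮.Q x - ContinuousLinearMap.id ℝ (TangentSpace I x)

variable [FiniteDimensional ℝ E]

/-- `h_i = (1/2) £_{ξ_i} f`. -/
def h (i : Fin s) (x : M) : TangentSpace I x →L[ℝ] TangentSpace I x :=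
  (1 / 2 : ℝ) • lieDerivTensor (𝒮.ξ i) 𝒮.f 𝒮.smooth_f x

/-- `h̃_i = Q⁻¹ h_i`. -/
def ht (i : Fin s) (x : M) : TangentSpace I x →L[ℝ] TangentSpace I x :=
  𝒮.Qinv x ∘L 𝒮.h i x

variable [RiemannianBundle (fun x : M ↦ TangentSpace I x)]
  [IsContMDiffRiemannianBundle I ∞ E (fun x : M ↦ TangentSpace I x)]

/-- The fundamental 2-form `Φ(X, Y) = g(X, f Y)`. -/
def Φ (x : M) (v w : TangentSpace I x) : ℝ := inner ℝ v (𝒮.f x w)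

/-- The metric is compatible: `g(f X, f Y) = g(X, Q Y) - ∑ η^i(X) η^i(Y)`. -/
def IsCompatibleMetric : Prop :=
  ∀ (x : M) (v w : TangentSpace I x),
    inner ℝ (𝒮.f x v) (𝒮.f x w) = inner ℝ v (𝒮.Q x w) - ∑ i, 𝒮.η i x v * 𝒮.η i x w

/-- Weak almost `𝒮`-structure: a weak metric `f`-structure with `Φ = dη^1 = ... = dη^s`. -/
structure IsWeakAlmostS : Prop where
  compatible : 𝒮.IsCompatibleMetric
  Φ_eq : ∀ (i : Fin s) (X Y : Π x : M, TangentSpace I x), CMDiff ∞ (T% X) → CMDiff ∞ (T% Y) →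
    ∀ x, 𝒮.Φ x (X x) (Y x) = extDeriv₁ (𝒮.η i) X Y x

/-- `R_{X,Y} ξ_i = 0` for all vector fields `X, Y` and all `i`. -/
def ReebCurvatureZero : Prop :=
  ∀ (X Y : Π x : M, TangentSpace I x), CMDiff ∞ (T% X) → CMDiff ∞ (T% Y) →
    ∀ i x, curvature X Y (𝒮.ξ i) x = 0

/-- `£_{ξ_i} Q = 0` for all `i`. -/
def ReebPreservesQ : Prop :=
  ∀ i, ∀ X : Π x : M, TangentSpace I x, CMDiff ∞ (T% X) →
    ∀ x, lieDerivEndo (𝒮.ξ i) 𝒮.Q X x = 0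

/-- `(∇_X Q) Y = 0` for all vector fields `X, Y` tangent to the contact distribution. -/
def QParallelOnContact : Prop :=
  ∀ (X Y : Π x : M, TangentSpace I x), CMDiff ∞ (T% X) → CMDiff ∞ (T% Y) →
    (∀ x, X x ∈ 𝒮.contact x) → (∀ x, Y x ∈ 𝒮.contact x) → ∀ x, nablaEndo 𝒮.Q X Y x = 0

end FramedWeakFStructure

end Manifold

end WeakF

end

/-! Write A_i for the endomorphism ∇ξ_i. The condition Φ = dη^i says that the adjoint of A_i is A_i
+ 2f, and R ξ_i = 0 says that (∇_X A_i)Y is symmetric in X and Y (Codazzi). At a point, what remains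
is linear algebra in f, Q, A_i and their covariant derivatives, collected in `IsReebFlat`.

Closedness of Φ and orthonormality of the ξ_i give A_i ξ_j = 0 (`IsReebFlat.A_ξ`); together with
£_{ξ_i} Q = 0 they give A_i f + f A_i + 2f² = 0, which is the same as ∇_{ξ_i} f = 0
(`IsReebFlat.A_f`). Both identities hold at every point, so they can be differentiated. In the
direction ξ_j, Codazzi turns the result into (A_i + f)(A_j + f) = -f²
(`IsReebFlat.A_add_f_A_add_f`), whence all A_i coincide. Thus S = A_i + f is symmetric, anticommutes
with f, satisfies S² = -f², and h̃ = Q⁻¹ f S. For c ≠ 0 the equation h̃v = cv means that v lies in 𝒟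
and Sv = -c fv; hence c² = 1, and f exchanges the two eigenspaces (`IsSplitting`).

If Q is parallel on 𝒟, then Q = I (`IsReebFlat.Q_eq_id`), so f² = -I on 𝒟. The symmetries of ⟨(∇_x
A)y, z⟩ relative to 𝒟 = 𝒟⁺ ⊕ 𝒟⁻ then force it to vanish (`trilinear_eq_zero`). Half its skew part in
y, z is ∇Φ, which therefore vanishes on 𝒟. As Q̃ = 0 too, every term in (i)–(iii) is zero. -/

noncomputable section

namespace WeakF

open scoped Topology

/-! ### Pointwise linear algebra of f, Q, ∇ξ_i and their covariant derivatives. -/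

section LinearAlgebra

variable {V : Type*} [NormedAddCommGroup V] [InnerProductSpace ℝ V]

/-- A weak metric `f`-structure on a Euclidean vector space, in terms of orthonormal vectors `ξ`
spanning the kernel of the skew-symmetric map `f`. -/
structure IsLinearWeakF {s : ℕ} (f Q : V →ₗ[ℝ] V) (ξ : Fin s → V) : Prop where
  orthonormal : ∀ i j, inner ℝ (ξ i) (ξ j) = if i = j then (1 : ℝ) else 0
  f_sq : ∀ v, f (f v) = -Q v + ∑ i, inner ℝ v (ξ i) • ξ i
  skew : ∀ v w, inner ℝ (f v) w = -inner ℝ v (f w)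
  f_ξ : ∀ i, f (ξ i) = 0
  Q_ξ : ∀ i, Q (ξ i) = ξ i
  bijective : Function.Bijective Q

/-- The relations at a point between a weak metric `f`-structure, the endomorphisms
`A i = ∇ξ_i`, and the covariant derivatives `F`, `P`, `G i` of `f`, `Q` and `A i`. -/
structure IsReebFlat {s : ℕ} (f Q : V →ₗ[ℝ] V) (ξ : Fin s → V) (A : Fin s → V →ₗ[ℝ] V)
    (F P : V →ₗ[ℝ] V →ₗ[ℝ] V) (G : Fin s → V →ₗ[ℝ] V →ₗ[ℝ] V) : Prop
    extends IsLinearWeakF f Q ξ where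
  A_sub_adjoint : ∀ i v w, inner ℝ (A i v) w - inner ℝ v (A i w) = 2 * inner ℝ v (f w)
  codazzi : ∀ i v w, G i v w = G i w v
  G_sub_adjoint : ∀ i v w z, inner ℝ (G i v w) z - inner ℝ w (G i v z) = 2 * inner ℝ w (F v z)
  F_skew : ∀ v w z, inner ℝ (F v w) z = -inner ℝ w (F v z)
  A_skew : ∀ i j v, inner ℝ (A i v) (ξ j) = -inner ℝ (ξ i) (A j v)
  F_ξ : ∀ j v, F v (ξ j) = -f (A j v)
  lie_Q : ∀ i v, P (ξ i) v + Q (A i v) - A i (Q v) = 0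
  F_f : ∀ v w, F v (f w) + f (F v w) =
    -P v w + ∑ i, (inner ℝ w (A i v) • ξ i + inner ℝ w (ξ i) • A i v)

namespace IsLinearWeakF

variable {s : ℕ} {f Q : V →ₗ[ℝ] V} {ξ : Fin s → V} (h : IsLinearWeakF f Q ξ)
include h

theorem inner_f_ξ (v : V) (i : Fin s) : inner ℝ (f v) (ξ i) = 0 := by
  rw [h.skew, h.f_ξ, inner_zero_right, neg_zero]

/-- On the complement of the ξ i, f² = -Q and Q is injective, so f is injective there. Identities
between vectors of the complement are therefore checked after applying f. -/
theorem eq_zero {v : V} (hv : f v = 0) (hD : ∀ i, inner ℝ v (ξ i) = 0) : v = 0 := by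
  have := h.f_sq v
  simp only [hv, hD, map_zero, zero_smul, Finset.sum_const_zero, add_zero] at this
  exact h.bijective.1 (by rw [map_zero]; exact neg_eq_zero.1 this.symm)

theorem f_eq_zero {v : V} (hv : f (f v) = 0) : f v = 0 :=
  h.eq_zero hv fun i ↦ h.inner_f_ξ v i

theorem sum_smul_inner_ξ (c : Fin s → ℝ) (j : Fin s) : inner ℝ (∑ i, c i • ξ i) (ξ j) = c j := by
  simp [sum_inner, inner_smul_left, h.orthonormal]

theorem eq_sum_of_f_eq_zero {v : V} (hv : f v = 0) : v = ∑ i, inner ℝ v (ξ i) • ξ i := by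
  rw [← sub_eq_zero]
  refine h.eq_zero ?_ fun j ↦ ?_
  · simp [hv, h.f_ξ]
  · rw [inner_sub_left, h.sum_smul_inner_ξ, sub_self]

theorem inner_Q_ξ (v : V) (i : Fin s) : inner ℝ (Q v) (ξ i) = inner ℝ v (ξ i) := by
  have e : Q v = ∑ i, inner ℝ v (ξ i) • ξ i - f (f v) := by rw [h.f_sq]; abel
  rw [e, inner_sub_left, h.sum_smul_inner_ξ, h.inner_f_ξ, sub_zero]

theorem Q_eq {v : V} (hv : ∀ i, inner ℝ v (ξ i) = 0) : Q v = -f (f v) := by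
  rw [h.f_sq]; simp [hv]

/-- f maps onto the complement of the ξ i: the Q-preimage of a vector of the complement stays there,
where Q = -f². No dimension count is needed. -/
theorem exists_eq (v : V) : ∃ u, v = ∑ i, inner ℝ v (ξ i) • ξ i + f u := by
  obtain ⟨w, hw⟩ := h.bijective.2 (v - ∑ i, inner ℝ v (ξ i) • ξ i)
  have hwD (i) : inner ℝ w (ξ i) = 0 := by
    rw [← h.inner_Q_ξ, hw, inner_sub_left, h.sum_smul_inner_ξ, sub_self]
  refine ⟨-f w, ?_⟩
  rw [map_neg, ← h.Q_eq hwD, hw]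
  abel

end IsLinearWeakF

namespace IsReebFlat

variable {s : ℕ} {f Q : V →ₗ[ℝ] V} {ξ : Fin s → V} {A : Fin s → V →ₗ[ℝ] V}
  {F P : V →ₗ[ℝ] V →ₗ[ℝ] V} {G : Fin s → V →ₗ[ℝ] V →ₗ[ℝ] V} (h : IsReebFlat f Q ξ A F P G)
include h

/-- The fundamental form is closed. -/
theorem cyclic (i : Fin s) (u v w : V) :
    inner ℝ v (F u w) + inner ℝ w (F v u) + inner ℝ u (F w v) = 0 := by
  -- In the cyclic sum, Codazzi makes the terms in G i cancel in pairs.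
  have h1 := h.G_sub_adjoint i u v w
  have h2 := h.G_sub_adjoint i v w u
  have h3 := h.G_sub_adjoint i w u v
  rw [h.codazzi i w u, real_inner_comm] at h3
  rw [h.codazzi i v u, real_inner_comm] at h2
  rw [h.codazzi i w v] at h3
  have e1 := real_inner_comm v (G i u w)
  have e2 := real_inner_comm w (G i u v)
  have e3 := real_inner_comm u (G i v w)
  linarith

theorem A_ξ_swap (i j : Fin s) : A i (ξ j) = -A j (ξ i) := by
  refine ext_inner_right ℝ fun v ↦ ?_
  have h1 := h.A_sub_adjoint i (ξ j) v
  have h2 := h.A_sub_adjoint j (ξ i) v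
  have h3 := h.A_skew i j v
  have e1 := h.toIsLinearWeakF.inner_f_ξ v j
  have e2 := h.toIsLinearWeakF.inner_f_ξ v i
  rw [real_inner_comm] at h3 e1 e2
  rw [e1] at h1
  rw [e2] at h2
  rw [inner_neg_left]
  linarith

/-- Closedness of Φ on a triple (v, ξ i, ξ j) makes f (A i (ξ j)) symmetric in i, j, while
`A_ξ_swap` makes it antisymmetric. -/
theorem f_A_ξ (i j : Fin s) : f (A i (ξ j)) = 0 := by
  have key : f (A i (ξ j)) = f (A j (ξ i)) := by
    refine ext_inner_right ℝ fun v ↦ ?_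
    have h1 := h.cyclic i v (ξ i) (ξ j)
    rw [h.F_ξ j v, h.F_ξ i (ξ j), inner_neg_right, inner_neg_right,
      real_inner_comm _ (ξ i), h.toIsLinearWeakF.inner_f_ξ] at h1
    have h2 := h.F_skew (ξ i) v (ξ j)
    rw [h.F_ξ, inner_neg_right, neg_neg, real_inner_comm] at h2
    rw [h2, real_inner_comm _ v, real_inner_comm _ v] at h1
    linarith
  have h1 : f (A i (ξ j)) = -f (A i (ξ j)) := by
    nth_rw 1 [key, h.A_ξ_swap j i, map_neg]
  have h2 : (2 : ℝ) • f (A i (ξ j)) = 0 := by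
    rw [two_smul]
    nth_rw 2 [h1]
    exact add_neg_cancel _
  exact (smul_eq_zero.1 h2).resolve_left two_ne_zero

/-- By `f_A_ξ` only the components along the ξ k can survive. The array ⟨A i (ξ j), ξ k⟩ is
symmetric in j, k and antisymmetric in i, j, hence zero. -/
theorem A_ξ (i j : Fin s) : A i (ξ j) = 0 := by
  have hs (i j k) : inner ℝ (A i (ξ j)) (ξ k) = inner ℝ (A i (ξ k)) (ξ j) := by
    have := h.A_sub_adjoint i (ξ j) (ξ k)
    rw [h.f_ξ, inner_zero_right, mul_zero, real_inner_comm _ (ξ j)] at this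
    linarith
  have ha (i j k) : inner ℝ (A i (ξ j)) (ξ k) = -inner ℝ (A j (ξ i)) (ξ k) := by
    rw [h.A_ξ_swap, inner_neg_left]
  refine h.toIsLinearWeakF.eq_zero (h.f_A_ξ i j) fun k ↦ ?_
  linarith [hs i j k, ha i k j, hs k i j, ha k j i, hs j k i, ha j i k]

theorem inner_A_ξ (i j : Fin s) (v : V) : inner ℝ (A i v) (ξ j) = 0 := by
  have := h.A_sub_adjoint i v (ξ j)
  rw [h.A_ξ, h.f_ξ] at this
  simpa using this

/-- Closedness of Φ expresses ∇_{ξ i} f through the derivatives f (A i ·) of f (ξ i) = 0. -/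
theorem F_ξ_left (i : Fin s) (v : V) : F (ξ i) v = -(A i (f v) + f (A i v) + (2 : ℝ) • f (f v)) := by
  refine ext_inner_left ℝ fun w ↦ ?_
  have h1 := h.cyclic i (ξ i) w v
  rw [h.F_ξ, real_inner_comm _ (ξ i), h.F_skew, h.F_ξ, inner_neg_right, inner_neg_right,
    real_inner_comm _ v, h.toIsLinearWeakF.skew] at h1
  have h2 := h.A_sub_adjoint i w (f v)
  simp only [inner_neg_right, inner_add_right, inner_smul_right]
  linarith

/-- Let B be the left side, so that ∇_{ξ i} f = -B. Differentiating f² = -Q + Σ η ⊗ ξ along ξ i,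
with £Q = 0 and Q = -f² on the complement, gives B f + f B = f² A - A f². Expanding B on the left
turns this into 2 B f = 0. Since B also kills the ξ j, it vanishes. -/
theorem A_f (i : Fin s) (v : V) : A i (f v) + f (A i v) + (2 : ℝ) • f (f v) = 0 := by
  let B : V → V := fun v ↦ A i (f v) + f (A i v) + (2 : ℝ) • f (f v)
  have hF (v) : F (ξ i) v = -B v := h.F_ξ_left i v
  have hQA (v) : Q (A i v) = -f (f (A i v)) := h.toIsLinearWeakF.Q_eq fun j ↦ h.inner_A_ξ i j v
  have hAQ (v) : A i (Q v) = -A i (f (f v)) := by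
    have e : Q v = ∑ i, inner ℝ v (ξ i) • ξ i - f (f v) := by rw [h.f_sq]; abel
    rw [e]
    simp [h.A_ξ]
  have h1 (v) : B (f v) + f (B v) = f (f (A i v)) - A i (f (f v)) := by
    have := h.F_f (ξ i) v
    have h3 := h.lie_Q i v
    rw [hQA, hAQ] at h3
    simp only [hF, h.A_ξ, inner_zero_right, zero_smul, smul_zero, add_zero,
      Finset.sum_const_zero, map_neg] at this
    have e : P (ξ i) v = f (f (A i v)) - A i (f (f v)) := by
      rw [← sub_eq_zero, ← h3]; abel
    rw [e] at this
    rw [← neg_inj, neg_add]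
    exact this
  have h2 (v) : B (f v) = 0 := by
    have := h1 v
    simp only [B, map_add, map_smul] at this ⊢
    have e : (2 : ℝ) • (A i (f (f v)) + f (A i (f v)) + (2 : ℝ) • f (f (f v))) = 0 := by
      linear_combination (norm := module) this
    exact (smul_eq_zero.1 e).resolve_left two_ne_zero
  have h3 (j) : B (ξ j) = 0 := by simp [B, h.f_ξ, h.A_ξ]
  obtain ⟨u, hu⟩ := h.toIsLinearWeakF.exists_eq v
  let L : V →ₗ[ℝ] V := A i ∘ₗ f + f ∘ₗ A i + (2 : ℝ) • f ∘ₗ f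
  have hL (v) : L v = B v := by simp [L, B]
  change B v = 0
  rw [← hL, hu, map_add, map_sum, hL, h2]
  simp only [map_smul]
  simp only [hL, h3, smul_zero, Finset.sum_const_zero, add_zero]

theorem F_ξ_left_eq_zero (i : Fin s) (v : V) : F (ξ i) v = 0 := by
  rw [h.F_ξ_left, h.A_f, neg_zero]

/-- The derivative of `A i (ξ j) = 0`. -/
def DerivAξ (ξ : Fin s → V) (A : Fin s → V →ₗ[ℝ] V) (G : Fin s → V →ₗ[ℝ] V →ₗ[ℝ] V) : Prop :=
  ∀ i j v, G i v (ξ j) = -A i (A j v)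

/-- The derivative of `A i ∘ f + f ∘ A i + 2 f² = 0`. -/
def DerivAf (f : V →ₗ[ℝ] V) (A : Fin s → V →ₗ[ℝ] V) (F : V →ₗ[ℝ] V →ₗ[ℝ] V)
    (G : Fin s → V →ₗ[ℝ] V →ₗ[ℝ] V) : Prop :=
  ∀ i v w, G i v (f w) + A i (F v w) + F v (A i w) + f (G i v w)
    + (2 : ℝ) • (F v (f w) + f (F v w)) = 0

/-- This says (A i + f)(A j + f) = -f². In the direction ξ j the derivative of `A_f` loses its ∇f
terms, and Codazzi replaces G i (ξ j) w by G i w (ξ j) = -A i (A j w). Hence A i A j anticommutes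
with f. Moving f to the left by `A_f` gives 2f applied to the claim, and f is injective on the
complement. -/
theorem A_add_f_A_add_f (h1 : DerivAξ ξ A G) (h2 : DerivAf f A F G) (i j : Fin s) (v : V) :
    A i (A j v) + A i (f v) + f (A j v) + (2 : ℝ) • f (f v) = 0 := by
  have e (w) : A i (A j (f w)) + f (A i (A j w)) = 0 := by
    have := h2 i (ξ j) w
    simp only [h.F_ξ_left_eq_zero, h.codazzi i (ξ j), h1 i j, map_zero, map_neg] at this
    rw [← neg_eq_zero, ← this]
    module
  have hf (w) : f (A i (f w)) = -f (f (A i w)) - (2 : ℝ) • f (f (f w)) := by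
    have := congrArg f (h.A_f i w)
    simp only [map_add, map_smul, map_zero] at this
    linear_combination (norm := module) this
  have e3 := e v
  have e4 : A j (f v) = -f (A j v) - (2 : ℝ) • f (f v) := by
    linear_combination (norm := module) h.A_f j v
  have e5 := h.A_f i (A j v)
  have e6 := h.A_f i (f v)
  rw [e4, map_sub, map_neg, map_smul] at e3
  refine h.toIsLinearWeakF.eq_zero ?_ fun k ↦ ?_
  · simp only [map_add, map_smul]
    have e7 : (2 : ℝ) • (f (A i (A j v)) + f (A i (f v)) + f (f (A j v)) + (2 : ℝ) • f (f (f v)))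
        = 0 := by
      linear_combination (norm := module) e3 + e5 + (2 : ℝ) • e6
    exact (smul_eq_zero.1 e7).resolve_left two_ne_zero
  · simp [inner_add_left, inner_smul_left, h.toIsLinearWeakF.inner_f_ξ, h.inner_A_ξ]

theorem A_A (h1 : DerivAξ ξ A G) (h2 : DerivAf f A F G) (i : Fin s) (v : V) :
    A i (A i v) = 0 := by
  linear_combination (norm := module) h.A_add_f_A_add_f h1 h2 i i v - h.A_f i v

/-- The quadratic identities for (i, i) and (i, j) differ by (A i + f) d = 0, where d = A i v - A j
v. Applying A i and f to this and comparing with `A_f` leaves f² d = 0. -/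
theorem A_eq (h1 : DerivAξ ξ A G) (h2 : DerivAf f A F G) (i j : Fin s) : A i = A j := by
  ext v
  have e1 := h.A_add_f_A_add_f h1 h2 i i v
  have e2 := h.A_add_f_A_add_f h1 h2 i j v
  set d := A i v - A j v with hd
  have e3 : A i d + f d = 0 := by
    rw [hd, map_sub, map_sub]
    linear_combination (norm := module) e1 - e2
  have e4 : f (f d) = 0 := by
    have e5 := congrArg (A i) e3
    have e6 := h.A_f i d
    have e7 := congrArg f e3
    rw [map_add, h.A_A h1 h2, map_zero, zero_add] at e5
    rw [map_add, map_zero] at e7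
    linear_combination (norm := module) e6 - e5 - e7
  rw [← sub_eq_zero]
  refine h.toIsLinearWeakF.eq_zero (h.toIsLinearWeakF.f_eq_zero e4) fun k ↦ ?_
  rw [inner_sub_left, h.inner_A_ξ, h.inner_A_ξ, sub_zero]

/-- If `Q` is parallel on the orthogonal complement of the `ξ i`, then `Q` is the identity. -/
theorem Q_eq_id (hs : 0 < s)
    (hPs : ∀ v w z, inner ℝ (P v w) z = inner ℝ w (P v z))
    (hPξ : ∀ j v, P v (ξ j) = A j v - Q (A j v))
    (hP : ∀ v w, (∀ i, inner ℝ v (ξ i) = 0) → (∀ i, inner ℝ w (ξ i) = 0) → P v w = 0) (v : V) :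
    Q v = v := by
  let i : Fin s := ⟨0, hs⟩
  have hL := h.toIsLinearWeakF
  have e1 (v) (hv : ∀ i, inner ℝ v (ξ i) = 0) : Q (A i v) = A i v := by
    -- The vector z = f² A v + A v equals P v (ξ i). As P v is symmetric and vanishes on the
    -- complement, which contains z, ⟨z, z⟩ = ⟨P v z, ξ i⟩ = 0.
    have e2 : f (f (A i v)) + A i v = 0 := by
      have hD (j) : inner ℝ (f (f (A i v)) + A i v) (ξ j) = 0 := by
        rw [inner_add_left, hL.inner_f_ξ, h.inner_A_ξ, add_zero]
      rw [← inner_self_eq_zero (𝕜 := ℝ)]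
      have := hPs v (f (f (A i v)) + A i v) (ξ i)
      rw [hP v _ hv hD, inner_zero_left, hPξ, hL.Q_eq fun j ↦ h.inner_A_ξ i j v] at this
      rw [add_comm, this, sub_neg_eq_add, add_comm]
    rw [hL.Q_eq fun j ↦ h.inner_A_ξ i j v, neg_eq_iff_add_eq_zero, e2]
  -- Compare f² A = -A at v and at f v, using `A_f` to move A past f: the terms in A cancel and 2(f⁴
  -- + f²)v = 0 remains.
  have e2 (v) (hv : ∀ i, inner ℝ v (ξ i) = 0) : f (f (f v)) = - f v := by
    have a1 := e1 v hv
    have a2 := e1 (f v) (hL.inner_f_ξ v)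
    rw [hL.Q_eq fun j ↦ h.inner_A_ξ i j v] at a1
    have a3 : A i (f v) = -f (A i v) - (2 : ℝ) • f (f v) := by
      linear_combination (norm := module) h.A_f i v
    rw [hL.Q_eq fun j ↦ h.inner_A_ξ i j (f v), a3] at a2
    have a4 := congrArg f a1
    simp only [map_neg, map_sub, map_smul] at a2 a4
    have a5 : f (f (f (f v)) + f v) = 0 := by
      rw [map_add]
      have a6 : (2 : ℝ) • (f (f (f (f v))) + f (f v)) = 0 := by
        linear_combination (norm := module) a2 + a4
      exact (smul_eq_zero.1 a6).resolve_left two_ne_zero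
    have a6 : f (f (f v)) + f v = 0 := by
      rw [← map_add] at a5 ⊢
      exact hL.f_eq_zero a5
    exact eq_neg_of_add_eq_zero_left a6
  obtain ⟨u, hu⟩ := hL.exists_eq v
  obtain ⟨w, hw⟩ := hL.exists_eq u
  have hfu : f u = f (f w) := by
    rw [hw, map_add, map_sum]
    simp [hL.f_ξ]
  have : Q (f u) = f u := by
    rw [hL.Q_eq (hL.inner_f_ξ u), hfu, e2 (f w) (hL.inner_f_ξ w), neg_neg]
  rw [hu, map_add, this]
  simp [hL.Q_ξ]

end IsReebFlat

/-- The trilinear form of `∇A` vanishes on the orthogonal complement of the `ξ i`. -/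
theorem trilinear_eq_zero {W : Submodule ℝ V} {f A : V →ₗ[ℝ] V} {a : V → V → V → ℝ}
    (ha₁ : ∀ x x' y z, a (x + x') y z = a x y z + a x' y z)
    (ha₂ : ∀ x y y' z, a x (y + y') z = a x y z + a x y' z)
    (ha₃ : ∀ x y z z', a x y (z + z') = a x y z + a x y z')
    (hc₂ : ∀ (c : ℝ) x y z, a x (c • y) z = c * a x y z)
    (hc₃ : ∀ (c : ℝ) x y z, a x y (c • z) = c * a x y z)
    (hfW : ∀ v, f v ∈ W) (hff : ∀ v ∈ W, f (f v) = -v)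
    (hAf : ∀ v, A (f v) + f (A v) + (2 : ℝ) • f (f v) = 0) (hAA : ∀ v, A (A v) = 0)
    (hAW : ∀ v, A v ∈ W)
    (hsymm : ∀ x y z, a x y z = a y x z)
    (hβ : ∀ x y z, a x (A y) z + a x y (A z + (2 : ℝ) • f z) = 0)
    (hγ : ∀ x ∈ W, ∀ y ∈ W, ∀ z ∈ W, 2 * a x (f y) z + a x (A z + (2 : ℝ) • f z) y
      + a x z (A y) - 2 * a x y (f z) = 0)
    {x y z : V} (hx : x ∈ W) (hy : y ∈ W) (hz : z ∈ W) : a x y z = 0 := by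
  -- Let K be the solutions in W of A p = -2 f p, that is, of (A + f) p = -f p; this is 𝒟⁺. The
  -- claim is W = K + fK, and A kills fK. The K-part of v is ½ f A v.
  have dec : ∀ v ∈ W, ∃ p q, p ∈ W ∧ q ∈ W ∧ A p = (-2 : ℝ) • f p ∧ A q = (-2 : ℝ) • f q ∧
      v = p + f q := by
    intro v hv
    have h1 : A (f (A v)) = (-2 : ℝ) • f (f (A v)) := by
      have := hAf (A v)
      rw [hAA, map_zero] at this
      linear_combination (norm := module) this
    rw [hff _ (hAW v)] at h1
    have hp : (1 / 2 : ℝ) • f (A v) ∈ W := W.smul_mem _ (hfW _)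
    refine ⟨(1 / 2 : ℝ) • f (A v), -f (v - (1 / 2 : ℝ) • f (A v)), hp, W.neg_mem (hfW _), ?_, ?_, ?_⟩
    · simp only [map_smul, h1, hff _ (hAW v)]
      module
    · have := hAf (v - (1 / 2 : ℝ) • f (A v))
      simp only [map_sub, map_smul, map_neg, h1, hff _ (hAW v), hff _ hv] at this ⊢
      linear_combination (norm := module) -this
    · rw [map_neg, hff _ (W.sub_mem hv hp)]
      abel
  have hAfp {p} (hp : A p = (-2 : ℝ) • f p) : A (f p) = 0 := by
    have := hAf p
    rw [hp, map_smul] at this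
    linear_combination (norm := module) this
  -- The hypothesis `hβ` comes from ∇(A²) = 0, with A + 2f the adjoint of A. On K and fK it reduces
  -- the components of a in its last two slots to those of types (K, K) and (K, fK).
  have k1 (x) {y z} (hy : A y = (-2 : ℝ) • f y) (hz : A z = (-2 : ℝ) • f z) : a x (f y) z = 0 := by
    have := hβ x y z
    rw [hy, hz, hc₂, ← add_smul, neg_add_cancel, hc₃] at this
    linarith
  have k2 (x) {y z} (hzW : z ∈ W) (hy : A y = (-2 : ℝ) • f y)
      (hz : A z = (-2 : ℝ) • f z) : a x (f y) (f z) = -a x y z := by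
    have := hβ x y (f z)
    rw [hy, hAfp hz, hff z hzW, hc₂, zero_add, hc₃, ← neg_one_smul ℝ z, hc₃] at this
    linarith
  have k3 {x y z} (hxW : x ∈ W) (hyW : y ∈ W) (hzW : z ∈ W) (hy : A y = (-2 : ℝ) • f y)
      (hz : A z = (-2 : ℝ) • f z) : a x y (f z) = -a x z (f y) := by
    have := hγ x hxW y hyW z hzW
    rw [k1 x hy hz, hy, hz, ← add_smul, neg_add_cancel, hc₂, hc₃] at this
    linarith
  -- The form a x y (f z) on K is antisymmetric in y, z by `k3` and symmetric in x, y, hence zero.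
  have m1 {x y z} (hxW : x ∈ W) (hyW : y ∈ W) (hzW : z ∈ W) (hx : A x = (-2 : ℝ) • f x)
      (hy : A y = (-2 : ℝ) • f y) (hz : A z = (-2 : ℝ) • f z) : a x y (f z) = 0 := by
    linarith [k3 hxW hyW hzW hy hz, hsymm x z (f y), k3 hzW hxW hyW hx hy, hsymm z y (f x),
      k3 hyW hzW hxW hz hx, hsymm y x (f z)]
  have m2 {x y z} (hxW : x ∈ W) (hyW : y ∈ W) (hzW : z ∈ W) (hx : A x = (-2 : ℝ) • f x)
      (hy : A y = (-2 : ℝ) • f y) (hz : A z = (-2 : ℝ) • f z) : a x y z = 0 := by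
    -- Passing through f y and f z by `k2` and `k3` makes a antisymmetric in its outer arguments on
    -- K; with symmetry in the first two it vanishes.
    have s1 {x y z} (hxW : x ∈ W) (hzW : z ∈ W) (hx : A x = (-2 : ℝ) • f x)
        (hy : A y = (-2 : ℝ) • f y) (hz : A z = (-2 : ℝ) • f z) : a x y z = -a z y x := by
      linarith [k2 x hzW hy hz, k2 z hxW hy hx, hsymm x (f y) (f z), hsymm z (f y) (f x),
        k3 (hfW y) hxW hzW hx hz]
    linarith [s1 hxW hzW hx hy hz, hsymm x y z, s1 hyW hzW hy hx hz, hsymm z x y,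
      s1 hzW hyW hz hx hy, hsymm y z x, hsymm z y x, s1 hxW hyW hx hz hy]
  obtain ⟨p, q, hpW, hqW, hp, hq, rfl⟩ := dec x hx
  obtain ⟨p', q', hpW', hqW', hp', hq', rfl⟩ := dec y hy
  obtain ⟨p'', q'', hpW'', hqW'', hp'', hq'', rfl⟩ := dec z hz
  simp only [ha₁, ha₂, ha₃]
  rw [k1 p hq' hp'', k1 (f q) hq' hp'', k2 p hqW'' hq' hq'', k2 (f q) hqW'' hq' hq'',
    hsymm (f q) p' p'', k1 p' hq hp'', hsymm (f q) p' (f q''), k2 p' hqW'' hq hq'',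
    hsymm (f q) q' q'', k1 q' hq hq'', m1 hpW hpW' hqW'' hp hp' hq'',
    m2 hpW hpW' hpW'' hp hp' hp'', m2 hpW hqW' hqW'' hp hq' hq'', m2 hpW' hqW hqW'' hp' hq hq'']
  simp

end LinearAlgebra

/-! ### Eigenspaces of T = Q⁻¹ f S. -/

section Splitting

variable {V : Type*} [NormedAddCommGroup V] [InnerProductSpace ℝ V]

/-- A symmetric endomorphism `S` anticommuting with `f`, with `S² = -f²`. -/
structure IsSplitting {s : ℕ} (f Q : V →ₗ[ℝ] V) (ξ : Fin s → V) (S : V →ₗ[ℝ] V) : Prop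
    extends IsLinearWeakF f Q ξ where
  S_f : ∀ v, S (f v) = -f (S v)
  S_S : ∀ v, S (S v) = -f (f v)
  S_ξ : ∀ i, S (ξ i) = 0
  inner_S_ξ : ∀ v i, inner ℝ (S v) (ξ i) = 0
  symm : ∀ v w, inner ℝ (S v) w = inner ℝ v (S w)

/-- The adjoint of A i is A i + 2f, so A i + f is its symmetric part. Anticommutation with f is
`A_f`, and the square is `A_add_f_A_add_f` with i = j. -/
theorem IsReebFlat.isSplitting {s : ℕ} {f Q : V →ₗ[ℝ] V} {ξ : Fin s → V} {A : Fin s → V →ₗ[ℝ] V}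
    {F P : V →ₗ[ℝ] V →ₗ[ℝ] V} {G : Fin s → V →ₗ[ℝ] V →ₗ[ℝ] V} (h : IsReebFlat f Q ξ A F P G)
    (h1 : DerivAξ ξ A G) (h2 : DerivAf f A F G) (i : Fin s) : IsSplitting f Q ξ (A i + f) where
  toIsLinearWeakF := h.toIsLinearWeakF
  S_f v := by
    simp only [LinearMap.add_apply, map_add]
    linear_combination (norm := module) h.A_f i v
  S_S v := by
    simp only [LinearMap.add_apply, map_add]
    linear_combination (norm := module) h.A_add_f_A_add_f h1 h2 i i v
  S_ξ j := by simp [h.A_ξ, h.f_ξ]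
  inner_S_ξ v j := by simp [inner_add_left, h.inner_A_ξ, h.toIsLinearWeakF.inner_f_ξ]
  symm v w := by
    have e1 := h.A_sub_adjoint i v w
    have e2 := h.skew v w
    simp only [LinearMap.add_apply, inner_add_left, inner_add_right]
    linarith

namespace IsSplitting

variable {s : ℕ} {f Q : V →ₗ[ℝ] V} {ξ : Fin s → V} {S : V →ₗ[ℝ] V} (h : IsSplitting f Q ξ S)
include h

theorem f_eq_zero_of_S_eq_zero {v : V} (hv : S v = 0) : f v = 0 := by
  refine h.f_eq_zero ?_
  have := h.S_S v
  rwa [hv, map_zero, zero_eq_neg] at this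

theorem eq_zero_of_f_S {v : V} (hv : f (S v) = 0) : f v = 0 :=
  h.f_eq_zero_of_S_eq_zero (h.eq_zero hv (h.inner_S_ξ v))

variable {T : V →ₗ[ℝ] V} (hT : ∀ v, Q (T v) = f (S v))
include hT

theorem eq_zero_iff {v : V} : T v = 0 ↔ f v = 0 := by
  constructor
  · intro hv
    refine h.eq_zero_of_f_S ?_
    rw [← hT, hv, map_zero]
  · intro hv
    have : Q (T v) = 0 := by
      rw [hT, h.toIsLinearWeakF.eq_sum_of_f_eq_zero hv]
      simp [h.S_ξ]
    exact h.bijective.1 (by rw [this, map_zero])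

theorem inner_T_ξ (v : V) (i : Fin s) : inner ℝ (T v) (ξ i) = 0 := by
  rw [← h.inner_Q_ξ, hT, h.toIsLinearWeakF.inner_f_ξ]

/-- T takes values in the complement, where Q = -f². There T v = c v reads f (S v) = -c f² v, and
one f can be cancelled. The criterion no longer involves Q. -/
theorem eq_smul_iff {c : ℝ} (hc : c ≠ 0) {v : V} :
    T v = c • v ↔ (∀ i, inner ℝ v (ξ i) = 0) ∧ S v = -c • f v := by
  constructor
  · intro hv
    have hD (i) : inner ℝ v (ξ i) = 0 := by
      have := h.inner_T_ξ hT v i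
      rw [hv, inner_smul_left] at this
      simpa [hc] using this
    refine ⟨hD, ?_⟩
    rw [← sub_eq_zero]
    refine h.eq_zero ?_ fun i ↦ ?_
    · rw [map_sub, map_smul, ← hT, hv, map_smul, h.Q_eq hD]
      module
    · rw [inner_sub_left, inner_smul_left, h.inner_S_ξ, h.toIsLinearWeakF.inner_f_ξ]
      simp
  · rintro ⟨hD, hv⟩
    apply h.bijective.1
    rw [hT, hv, map_smul, map_smul, h.Q_eq hD]
    module

theorem mem_eigenspace_iff {c : ℝ} (hc : c ≠ 0) {v : V} :
    v ∈ Module.End.eigenspace T c ↔ (∀ i, inner ℝ v (ξ i) = 0) ∧ S v = -c • f v := by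
  rw [Module.End.mem_eigenspace_iff, h.eq_smul_iff hT hc]

/-- From S v = -μ f v and S f = -f S one gets S² v = -μ² f² v, to be compared with S² = -f². -/
theorem eigenvalue {μ : ℝ} (hμ : Module.End.HasEigenvalue T μ) : μ = 0 ∨ μ = 1 ∨ μ = -1 := by
  obtain ⟨v, hv, hv0⟩ := hμ.exists_hasEigenvector
  rcases eq_or_ne μ 0 with h0 | h0
  · exact Or.inl h0
  obtain ⟨hD, hSv⟩ := (h.mem_eigenspace_iff hT h0).1 hv
  have h1 : (μ ^ 2 - 1) • f (f v) = 0 := by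
    have := h.S_S v
    rw [hSv, map_smul, h.S_f, hSv, map_smul] at this
    linear_combination (norm := module) -this
  rcases smul_eq_zero.1 h1 with h2 | h2
  · exact Or.inr (sq_eq_one_iff.1 (by linarith))
  · exact absurd (h.eq_zero (h.f_eq_zero h2) hD) hv0

/-- On the complement f S - c f² equals Q (T + c), a multiple of the eigenprojection composed with
Q. Being polynomial in f and S, it maps into the eigenspace without any appeal to Q⁻¹. -/
theorem sub_mem_eigenspace {c : ℝ} (hc : c ^ 2 = 1) (v : V) :
    f (S v) - c • f (f v) ∈ Module.End.eigenspace T c := by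
  rw [h.mem_eigenspace_iff hT (by rintro rfl; norm_num at hc)]
  refine ⟨fun i ↦ ?_, ?_⟩
  · rw [← map_smul, ← map_sub, h.toIsLinearWeakF.inner_f_ξ]
  · have hc' : c • c • f (f (f v)) = f (f (f v)) := by rw [smul_smul, ← sq, hc, one_smul]
    simp only [map_sub, map_smul, h.S_f, h.S_S, map_neg, neg_smul, smul_sub, smul_neg, hc']
    module

theorem sub_eq_of_mem_eigenspace {c : ℝ} (hc : c ≠ 0) {v : V}
    (hv : v ∈ Module.End.eigenspace T c) : f (S v) - c • f (f v) = (2 * c) • Q v := by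
  obtain ⟨hD, hSv⟩ := (h.mem_eigenspace_iff hT hc).1 hv
  rw [hSv, map_smul, h.Q_eq hD]
  module

theorem eigenspace_sup :
    ∀ v, v ∈ Module.End.eigenspace T 1 ⊔ Module.End.eigenspace T (-1) ↔
      ∀ i, inner ℝ v (ξ i) = 0 := by
  intro v
  constructor
  · intro hv i
    obtain ⟨a, ha, b, hb, rfl⟩ := Submodule.mem_sup.1 hv
    rw [inner_add_left, ((h.mem_eigenspace_iff hT one_ne_zero).1 ha).1,
      ((h.mem_eigenspace_iff hT (by norm_num)).1 hb).1, add_zero]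
  · intro hv
    obtain ⟨u, rfl⟩ := h.bijective.2 v
    have hu (i) : inner ℝ u (ξ i) = 0 := by rw [← h.inner_Q_ξ, hv]
    -- With v = Q u the two summands add up to -f² u = Q u.
    refine Submodule.mem_sup.2 ⟨(1 / 2 : ℝ) • (f (S u) - (1 : ℝ) • f (f u)),
      Submodule.smul_mem _ _ (h.sub_mem_eigenspace hT (by norm_num) u),
      (-1 / 2 : ℝ) • (f (S u) - (-1 : ℝ) • f (f u)),
      Submodule.smul_mem _ _ (h.sub_mem_eigenspace hT (by norm_num) u), ?_⟩
    rw [h.Q_eq hu]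
    module

theorem map_f_le {c : ℝ} (hc : c ≠ 0) :
    (Module.End.eigenspace T c).map f ≤ Module.End.eigenspace T (-c) := by
  rintro _ ⟨v, hv, rfl⟩
  obtain ⟨-, hSv⟩ := (h.mem_eigenspace_iff hT hc).1 hv
  refine (h.mem_eigenspace_iff hT (neg_ne_zero.2 hc)).2 ⟨h.toIsLinearWeakF.inner_f_ξ v, ?_⟩
  rw [h.S_f, hSv, map_smul]
  module

/-- Write v = Q w = -f² w. Then S u = -f u and S (f w) = -f² w, so symmetry of S on the pair u, f w
gives ⟨u, f² w⟩ = -⟨u, f² w⟩. -/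
theorem inner_eq_zero {u v : V} (hu : u ∈ Module.End.eigenspace T 1)
    (hv : v ∈ Module.End.eigenspace T (-1)) : inner ℝ u v = 0 := by
  obtain ⟨hDu, hSu⟩ := (h.mem_eigenspace_iff hT one_ne_zero).1 hu
  obtain ⟨hDv, hSv⟩ := (h.mem_eigenspace_iff hT (by norm_num)).1 hv
  obtain ⟨w, rfl⟩ := h.bijective.2 v
  have hw (i) : inner ℝ w (ξ i) = 0 := by rw [← h.inner_Q_ξ, hDv]
  rw [h.Q_eq hw] at hSv ⊢
  have hw2 : S (f w) = -f (f w) := by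
    rw [← add_eq_zero_iff_eq_neg]
    refine h.eq_zero ?_ fun i ↦ ?_
    · have := hSv
      simp only [map_neg, h.S_f (f w)] at this
      rw [map_add]
      linear_combination (norm := module) this
    · rw [inner_add_left, h.inner_S_ξ, h.toIsLinearWeakF.inner_f_ξ, add_zero]
  have e1 := h.symm u (f w)
  rw [hSu, hw2, inner_smul_left, h.skew, inner_neg_right] at e1
  simp only [map_neg, map_one] at e1
  rw [inner_neg_right]
  linarith

theorem injOn_f {c : ℝ} (hc : c ≠ 0) {v : V} (hv : v ∈ Module.End.eigenspace T c)
    (h0 : f v = 0) : v = 0 :=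
  h.eq_zero h0 ((h.mem_eigenspace_iff hT hc).1 hv).1

variable [FiniteDimensional ℝ V]

theorem finrank_map_f {c : ℝ} (hc : c ≠ 0) :
    finrank ℝ ((Module.End.eigenspace T c).map f) = finrank ℝ (Module.End.eigenspace T c) := by
  rw [← LinearMap.range_domRestrict]
  refine LinearMap.finrank_range_of_inj ((injective_iff_map_eq_zero _).2 fun v hv ↦ ?_)
  exact Subtype.ext (h.injOn_f hT hc v.2 hv)

theorem finrank_eigenspace_neg :
    finrank ℝ (Module.End.eigenspace T (-1)) = finrank ℝ (Module.End.eigenspace T 1) := by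
  apply le_antisymm
  · rw [← h.finrank_map_f hT (by norm_num : (-1 : ℝ) ≠ 0)]
    have := h.map_f_le hT (by norm_num : (-1 : ℝ) ≠ 0)
    rw [neg_neg] at this
    exact Submodule.finrank_mono this
  · rw [← h.finrank_map_f hT one_ne_zero]
    exact Submodule.finrank_mono (h.map_f_le hT one_ne_zero)

theorem map_f_eq {c : ℝ} (hc : c = 1 ∨ c = -1) :
    (Module.End.eigenspace T c).map f = Module.End.eigenspace T (-c) := by
  have e := h.finrank_eigenspace_neg hT
  rcases hc with rfl | rfl
  · refine Submodule.eq_of_le_of_finrank_eq (h.map_f_le hT one_ne_zero) ?_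
    rw [h.finrank_map_f hT one_ne_zero, e]
  · refine Submodule.eq_of_le_of_finrank_eq (h.map_f_le hT (by norm_num)) ?_
    rw [h.finrank_map_f hT (by norm_num), e, neg_neg]

/-- f embeds each eigenspace in the other, so their dimensions agree; their direct sum is the range
of f, of dimension 2n. -/
theorem finrank_eigenspace {n : ℕ} (hn : finrank ℝ (LinearMap.range f) = 2 * n) :
    finrank ℝ (Module.End.eigenspace T 1) = n ∧ finrank ℝ (Module.End.eigenspace T (-1)) = n := by
  have e := h.finrank_eigenspace_neg hT
  have e1 : Module.End.eigenspace T 1 ⊔ Module.End.eigenspace T (-1) = LinearMap.range f := by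
    ext v
    rw [h.eigenspace_sup hT]
    constructor
    · intro hv
      obtain ⟨u, hu⟩ := h.toIsLinearWeakF.exists_eq v
      exact ⟨u, by rw [hu]; simp [hv]⟩
    · rintro ⟨u, rfl⟩
      exact h.toIsLinearWeakF.inner_f_ξ u
  have e2 : Module.End.eigenspace T 1 ⊓ Module.End.eigenspace T (-1) = ⊥ := by
    rw [Submodule.eq_bot_iff]
    rintro v ⟨h1, h2⟩
    exact inner_self_eq_zero.1 (h.inner_eq_zero hT h1 h2)
  have e3 := Submodule.finrank_sup_add_finrank_inf_eq (Module.End.eigenspace T 1)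
    (Module.End.eigenspace T (-1))
  rw [e1, e2, hn, finrank_bot] at e3
  omega

end IsSplitting

end Splitting

/-! ### Global extension of vector fields and smoothness of ∇_X Y. -/

section Smooth

variable {E : Type*} [NormedAddCommGroup E] [NormedSpace ℝ E] [FiniteDimensional ℝ E]
  {H : Type*} [TopologicalSpace H] {I : ModelWithCorners ℝ E H}
  {M : Type*} [TopologicalSpace M] [T2Space M] [ChartedSpace H M] [IsManifold I ∞ M]

/-- A smooth local field agrees near a given point with a smooth global one. -/
theorem exists_contMDiff_eventuallyEq {X : Π x : M, TangentSpace I x} {x : M} {U : Set M}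
    (hU : U ∈ 𝓝 x) (hX : CMDiff[U] ∞ (T% X)) :
    ∃ Y : Π x : M, TangentSpace I x, CMDiff ∞ (T% Y) ∧ ∀ᶠ y in 𝓝 x, Y y = X y := by
  obtain ⟨V, hVU, hV, hxV⟩ := mem_nhds_iff.mp hU
  obtain ⟨ψ, -, hψ⟩ := (SmoothBumpFunction.nhds_basis_tsupport (I := I) x).mem_iff.mp
    (hV.mem_nhds hxV)
  refine ⟨(ψ : M → ℝ) • X, ContMDiffOn.smul_section_of_tsupport ψ.contMDiff.contMDiffOn hV hψ
    (hX.mono hVU), ?_⟩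
  filter_upwards [ψ.eventuallyEq_one] with y hy
  simp [hy]

theorem exists_contMDiff_eq {x : M} (v : TangentSpace I x) :
    ∃ X : Π x : M, TangentSpace I x, CMDiff ∞ (T% X) ∧ X x = v := by
  obtain ⟨U, hU, h⟩ := FiberBundle.exists_contMDiffOn_extend (k := ∞) I E v
  obtain ⟨X, hX, e⟩ := exists_contMDiff_eventuallyEq hU h
  exact ⟨X, hX, by simpa using e.self_of_nhds⟩

omit [FiniteDimensional ℝ E] [T2Space M] in
theorem contMDiff_mvfderiv_apply {f : M → ℝ} (hf : CMDiff ∞ f) {X : Π x : M, TangentSpace I x}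
    (hX : CMDiff ∞ (T% X)) : CMDiff ∞ (fun x ↦ d% f x (X x)) := by
  have h1 := (hf.contMDiff_tangentMap (m := ∞) (by simp)).comp hX
  exact (contMDiff_snd_tangentBundle_modelSpace ℝ 𝓘(ℝ, ℝ)).comp h1

omit [T2Space M] in
theorem contMDiff_mlieBracket {X Y : Π x : M, TangentSpace I x} (hX : CMDiff ∞ (T% X))
    (hY : CMDiff ∞ (T% Y)) : CMDiff ∞ (T% (mlieBracket I X Y)) :=
  haveI : IsManifold I (minSmoothness ℝ 2) M := by
    rw [minSmoothness_of_isRCLikeNormedField]; infer_instance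
  haveI : IsManifold I ((⊤ : ℕ∞) + 1) M := by
    simpa using ‹IsManifold I ∞ M›
  fun x ↦ ContMDiffAt.mlieBracket_vectorField (m := ⊤) (n := ⊤) (hX x) (hY x) (by simp)

omit [T2Space M] [FiniteDimensional ℝ E] in
theorem SmoothEndo.contMDiff_apply {S : Π x : M, TangentSpace I x →L[ℝ] TangentSpace I x}
    (hS : SmoothEndo S) {X : Π x : M, TangentSpace I x} (hX : CMDiff ∞ (T% X)) :
    CMDiff ∞ (T% (fun y ↦ S y (X y))) :=
  ContMDiff.clm_bundle_apply (IM := I) (IB := I) (F₁ := E) (F₂ := E)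
    (E₁ := fun x : M ↦ TangentSpace I x) (E₂ := fun x : M ↦ TangentSpace I x) (b := id) hS hX

theorem contMDiff_mdiffAt {X : Π x : M, TangentSpace I x} (hX : CMDiff ∞ (T% X)) (x : M) :
    MDiffAt (T% X) x := (hX x).mdifferentiableAt (by simp)

variable [RiemannianBundle (fun x : M ↦ TangentSpace I x)]
  [IsContMDiffRiemannianBundle I ∞ E (fun x : M ↦ TangentSpace I x)]

theorem contMDiff_inner {X Y : Π x : M, TangentSpace I x} (hX : CMDiff ∞ (T% X))
    (hY : CMDiff ∞ (T% Y)) : CMDiff ∞ (fun y ↦ inner ℝ (X y) (Y y)) :=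
  ContMDiff.inner_bundle (F := E) (E := fun x : M ↦ TangentSpace I x) (IB := I) (b := id) hX hY

/-- A field is smooth if its inner products with all smooth fields are smooth. -/
theorem contMDiff_of_inner {V : Π x : M, TangentSpace I x}
    (h : ∀ Z : Π x : M, TangentSpace I x, CMDiff ∞ (T% Z) →
      CMDiff ∞ (fun y ↦ inner ℝ (V y) (Z y))) : CMDiff ∞ (T% V) := by
  intro x
  let e := trivializationAt E (fun x : M ↦ TangentSpace I x) x
  let b := Module.finBasis ℝ E
  have hx : x ∈ e.baseSet := FiberBundle.mem_baseSet_trivializationAt' x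
  have hb : e.baseSet ∈ 𝓝 x := e.open_baseSet.mem_nhds hx
  -- The hypothesis tests global fields only, so the local frame is replaced by global fields that
  -- agree with it near x.
  have hex (a) : ∃ Y : Π x : M, TangentSpace I x, CMDiff ∞ (T% Y) ∧
      ∀ᶠ y in 𝓝 x, Y y = e.localFrame b a y :=
    exists_contMDiff_eventuallyEq hb (e.contMDiffOn_localFrame_baseSet ∞ b a)
  choose s hs hse using hex
  -- L is the Gram matrix of the frame. The coordinates of V are the inverse of L applied to the
  -- products ⟨V, s a⟩, and inversion is smooth.
  let L : M → (Fin (finrank ℝ E) → ℝ) →L[ℝ] (Fin (finrank ℝ E) → ℝ) := fun y ↦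
    ∑ a, ∑ c, (inner ℝ (s a y) (s c y) : ℝ) •
      (ContinuousLinearMap.proj (R := ℝ) (φ := fun _ : Fin (finrank ℝ E) ↦ ℝ) c).smulRight
        (Pi.single a (1 : ℝ))
  let u : M → (Fin (finrank ℝ E) → ℝ) := fun y a ↦ inner ℝ (V y) (s a y)
  have hL : CMDiff ∞ L := by
    refine contMDiff_finsetSum fun a _ ↦ contMDiff_finsetSum fun c _ ↦ ?_
    exact (contMDiff_inner (hs a) (hs c)).smul contMDiff_const
  have hu : ContMDiff I 𝓘(ℝ, Fin (finrank ℝ E) → ℝ) ∞ u := contMDiff_pi_space.2 fun a ↦ h _ (hs a)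
  have hLa (y : M) (k : Fin (finrank ℝ E) → ℝ) (a) :
      L y k a = inner ℝ (s a y) (∑ c, k c • s c y) := by
    simp [L, inner_sum, inner_smul_right, Finset.sum_apply,
      Pi.single_apply, mul_comm]
  have hfr : ∀ᶠ y in 𝓝 x, y ∈ e.baseSet ∧ ∀ a, s a y = e.localFrame b a y :=
    (Filter.eventually_of_mem hb fun _ h ↦ h).and (Filter.eventually_all.2 hse)
  have hinv : ∀ᶠ y in 𝓝 x, (L y).IsInvertible := by
    filter_upwards [hfr] with y hy
    have hli : LinearIndependent ℝ (fun a ↦ s a y) := by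
      have := (e.isLocalFrameOn_localFrame_baseSet I ∞ b).linearIndependent hy.1
      simpa only [hy.2] using this
    have hinj : Function.Injective (L y) := by
      rw [injective_iff_map_eq_zero]
      intro k hk
      have h0 : inner ℝ (∑ c, k c • s c y) (∑ c, k c • s c y) = 0 := by
        rw [sum_inner]
        refine Finset.sum_eq_zero fun a _ ↦ ?_
        rw [inner_smul_left, ← hLa, hk]
        simp
      rw [inner_self_eq_zero] at h0
      ext a
      exact Fintype.linearIndependent_iff.1 hli k h0 a
    exact ⟨(LinearEquiv.ofInjectiveEndo (L y).toLinearMap hinj).toContinuousLinearEquiv, by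
      ext; rfl⟩
  have hc : ContMDiffAt I 𝓘(ℝ, Fin (finrank ℝ E) → ℝ) ∞ (fun y ↦ (L y).inverse (u y)) x := by
    have h1 : CMDiffAt ∞ (fun y ↦ (L y).inverse) x :=
      (hinv.self_of_nhds.contDiffAt_map_inverse.contMDiffAt).comp x (hL x)
    exact h1.clm_apply (hu x)
  refine (contMDiffAt_iff_localFrameCoeff b hx).2 fun a ↦ ?_
  refine ((contMDiffAt_pi_space.1 hc) a).congr_of_eventuallyEq ?_
  filter_upwards [hfr, hinv] with y hy hyi
  have e1 : L y (fun a ↦ e.localFrameCoeff I b a y (V y)) = u y := by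
    ext a
    rw [hLa]
    simp only [u, hy.2]
    rw [real_inner_comm, ← e.eq_sum_localFrameCoeff_smul (I := I) (b := b) (s := V) hy.1]
  change _ = (L y).inverse (u y) a
  rw [← e1]
  obtain ⟨N, hN⟩ := hyi
  rw [← hN]
  simp

/-- The connection is defined pointwise by the Koszul formula, so smoothness is read off from it. It
makes ∇ξ_i preserve smooth fields, so that it can be differentiated again. -/
theorem contMDiff_nabla {X Y : Π x : M, TangentSpace I x} (hX : CMDiff ∞ (T% X))
    (hY : CMDiff ∞ (T% Y)) : CMDiff ∞ (T% (nabla X Y)) := by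
  refine contMDiff_of_inner fun Z hZ ↦ ?_
  have e : (fun y ↦ inner ℝ (nabla X Y y) (Z y)) = fun y ↦ (1 / 2 : ℝ) * koszul Y X Z y := by
    ext y
    rw [nabla, ← two_mul_inner_leviCivita (contMDiff_mdiffAt hX y) (contMDiff_mdiffAt hY y)
      (contMDiff_mdiffAt hZ y)]
    ring
  rw [e]
  refine contMDiff_const.mul ?_
  unfold koszul
  exact (((((contMDiff_mvfderiv_apply (contMDiff_inner hY hZ) hX).add
    (contMDiff_mvfderiv_apply (contMDiff_inner hZ hX) hY)).sub
    (contMDiff_mvfderiv_apply (contMDiff_inner hX hY) hZ)).add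
    (contMDiff_inner (contMDiff_mlieBracket hX hY) hZ)).sub
    (contMDiff_inner (contMDiff_mlieBracket hX hZ) hY)).sub
    (contMDiff_inner (contMDiff_mlieBracket hY hZ) hX)

end Smooth

/-! ### Covariant derivatives of (1,1)-tensors. -/

section Calculus

variable {E : Type*} [NormedAddCommGroup E] [NormedSpace ℝ E] [FiniteDimensional ℝ E]
  {H : Type*} [TopologicalSpace H] {I : ModelWithCorners ℝ E H}
  {M : Type*} [TopologicalSpace M] [T2Space M] [ChartedSpace H M] [IsManifold I ∞ M]
  [RiemannianBundle (fun x : M ↦ TangentSpace I x)]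
  [IsContMDiffRiemannianBundle I ∞ E (fun x : M ↦ TangentSpace I x)]

theorem nabla_zero (X : Π x : M, TangentSpace I x) (x : M) : nabla X 0 x = 0 := by
  rw [nabla, CovariantDerivative.zero]
  rfl

theorem nabla_add {X Y Z : Π x : M, TangentSpace I x} {x : M} (hY : MDiffAt (T% Y) x)
    (hZ : MDiffAt (T% Z) x) : nabla X (Y + Z) x = nabla X Y x + nabla X Z x := by
  simp only [nabla]
  rw [leviCivita.isCovariantDerivativeOnUniv.add hY hZ]
  rfl

theorem nabla_const_smul {X Y : Π x : M, TangentSpace I x} {x : M} (c : ℝ)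
    (hY : MDiffAt (T% Y) x) : nabla X (c • Y) x = c • nabla X Y x := by
  simp only [nabla]
  rw [leviCivita.isCovariantDerivativeOnUniv.smul_const c hY]
  rfl

theorem nabla_neg {X Y : Π x : M, TangentSpace I x} {x : M}
    (hY : MDiffAt (T% Y) x) : nabla X (-Y) x = -nabla X Y x := by
  rw [← neg_one_smul ℝ Y, nabla_const_smul _ hY, neg_one_smul]

theorem nabla_smul {X Y : Π x : M, TangentSpace I x} {x : M} {φ : M → ℝ} (hφ : MDiffAt φ x)
    (hY : MDiffAt (T% Y) x) :
    nabla X (φ • Y) x = φ x • nabla X Y x + d% φ x (X x) • Y x := by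
  simp only [nabla]
  rw [leviCivita.isCovariantDerivativeOnUniv.leibniz hY hφ]
  rfl

theorem nabla_sum {ι : Type*} (t : Finset ι) {X : Π x : M, TangentSpace I x}
    {Y : ι → Π x : M, TangentSpace I x} {x : M} (hY : ∀ i, CMDiff ∞ (T% (Y i))) :
    nabla X (fun y ↦ ∑ i ∈ t, Y i y) x = ∑ i ∈ t, nabla X (Y i) x := by
  classical
  induction t using Finset.induction_on with
  | empty =>
    simp only [Finset.sum_empty]
    exact nabla_zero X x
  | insert i t hi ih =>
    simp only [Finset.sum_insert hi]
    rw [← ih]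
    exact nabla_add (contMDiff_mdiffAt (hY i) x)
      (contMDiff_mdiffAt (ContMDiff.sum_section fun i _ ↦ hY i) x)

/-- A pair of mutually adjoint `(1,1)`-tensors, both sending smooth fields to smooth fields. -/
structure IsSmoothAdjoint (S S' : Π x : M, TangentSpace I x →L[ℝ] TangentSpace I x) : Prop where
  left : ∀ X : Π x : M, TangentSpace I x, CMDiff ∞ (T% X) → CMDiff ∞ (T% (fun y ↦ S y (X y)))
  right : ∀ X : Π x : M, TangentSpace I x, CMDiff ∞ (T% X) → CMDiff ∞ (T% (fun y ↦ S' y (X y)))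
  adjoint : ∀ x v w, inner ℝ (S x v) w = inner ℝ v (S' x w)

theorem inner_nablaEndo {S S' : Π x : M, TangentSpace I x →L[ℝ] TangentSpace I x}
    (h : IsSmoothAdjoint S S') {X Y Z : Π x : M, TangentSpace I x} (hX : CMDiff ∞ (T% X))
    (hY : CMDiff ∞ (T% Y)) (hZ : CMDiff ∞ (T% Z)) (x : M) :
    inner ℝ (nablaEndo S X Y x) (Z x) = inner ℝ (Y x) (nablaEndo S' X Z x) := by
  have h1 := leviCivita_metric (contMDiff_mdiffAt hX x) (contMDiff_mdiffAt (h.left Y hY) x)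
    (contMDiff_mdiffAt hZ x)
  have h2 := leviCivita_metric (contMDiff_mdiffAt hX x) (contMDiff_mdiffAt hY x)
    (contMDiff_mdiffAt (h.right Z hZ) x)
  simp only [h.adjoint] at h1
  rw [nablaEndo, nablaEndo, inner_sub_left, inner_sub_right, nabla, nabla, nabla, nabla, h.adjoint]
  linarith

/-- Adjointness moves the derivative from Y onto the test field, so the value at x depends on Y only
through Y x. Bilinearity then follows without a Leibniz computation. -/
theorem exists_nablaEndo_eq {S S' : Π x : M, TangentSpace I x →L[ℝ] TangentSpace I x}
    (h : IsSmoothAdjoint S S') (x : M) :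
    ∃ G : TangentSpace I x →ₗ[ℝ] TangentSpace I x →ₗ[ℝ] TangentSpace I x,
      ∀ X Y : Π x : M, TangentSpace I x, CMDiff ∞ (T% X) → CMDiff ∞ (T% Y) →
        nablaEndo S X Y x = G (X x) (Y x) := by
  choose ext hs hext using fun v : TangentSpace I x ↦ exists_contMDiff_eq (I := I) v
  have hpt {X Y : Π x : M, TangentSpace I x} (hX : CMDiff ∞ (T% X)) (hY : CMDiff ∞ (T% Y))
      (w : TangentSpace I x) : inner ℝ (nablaEndo S X Y x) w =
        inner ℝ (Y x) (nablaEndo S' (ext (X x)) (ext w) x) := by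
    have := inner_nablaEndo h hX hY (hs w) x
    rw [hext] at this
    rw [this]
    simp [nablaEndo, nabla, hext]
  refine ⟨LinearMap.mk₂ ℝ (fun v w ↦ nablaEndo S (ext v) (ext w) x) ?_ ?_ ?_ ?_, ?_⟩
  · intro v v' w
    simp only [nablaEndo, nabla, hext, map_add]
    abel
  · intro c v w
    simp only [nablaEndo, nabla, hext, map_smul, smul_sub]
  · intro v w w'
    refine ext_inner_right ℝ fun z ↦ ?_
    simp [hpt (hs _) (hs _), inner_add_left, hext]
  · intro c v w
    refine ext_inner_right ℝ fun z ↦ ?_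
    simp [hpt (hs _) (hs _), inner_smul_left, hext]
  · intro X Y hX hY
    refine ext_inner_right ℝ fun z ↦ ?_
    simp [hpt (hs _) (hs _), hpt hX hY, hext]

theorem nablaEndo_comp (S S' : Π x : M, TangentSpace I x →L[ℝ] TangentSpace I x)
    (X Y : Π x : M, TangentSpace I x) (x : M) :
    nabla X (fun y ↦ S y (S' y (Y y))) x = nablaEndo S X (fun y ↦ S' y (Y y)) x +
      S x (nablaEndo S' X Y x) + S x (S' x (nabla X Y x)) := by
  simp only [nablaEndo, map_sub]
  abel

theorem nablaForm_eq {S S' : Π x : M, TangentSpace I x →L[ℝ] TangentSpace I x}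
    (h : IsSmoothAdjoint S S') {X Y Z : Π x : M, TangentSpace I x}
    (hY : CMDiff ∞ (T% Y)) (hZ : CMDiff ∞ (T% Z)) (x : M) :
    nablaForm (fun x v w ↦ inner ℝ v (S x w)) X Y Z x =
      inner ℝ (Y x) (nablaEndo S X Z x) := by
  -- X need not be smooth; only its value at x enters.
  obtain ⟨X', hX', e⟩ := exists_contMDiff_eq (I := I) (X x)
  have h1 := leviCivita_metric (contMDiff_mdiffAt hX' x) (contMDiff_mdiffAt hY x)
    (contMDiff_mdiffAt (h.left Z hZ) x)
  rw [e] at h1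
  simp only [nablaForm, nablaEndo, nabla, h1, inner_sub_right]
  ring

end Calculus

/-! ### From the axioms of a weak metric f-structure to orthonormality and skewness. -/

section LinearWeakF

variable {V : Type*} [NormedAddCommGroup V] [InnerProductSpace ℝ V] [FiniteDimensional ℝ V]

/-- If f v = 0 then Q v, hence v, is a combination of the ξ i; the rank hypothesis makes this
inclusion ker f ≤ span ξ an equality. So f kills the ξ i, and compatibility with one argument ξ i
identifies η i with ⟨·, ξ i⟩. -/
theorem isLinearWeakF_of_rank {n s : ℕ} {f Q : V →ₗ[ℝ] V} {ξ : Fin s → V} {η : Fin s → V →ₗ[ℝ] ℝ}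
    (hdim : finrank ℝ V = 2 * n + s) (hf : finrank ℝ (LinearMap.range f) = 2 * n)
    (hQ : Function.Bijective Q) (hff : ∀ v, f (f v) = -Q v + ∑ i, η i v • ξ i)
    (hηξ : ∀ i j, η i (ξ j) = if i = j then 1 else 0) (hQξ : ∀ i, Q (ξ i) = ξ i)
    (hfg : ∀ v w, inner ℝ (f v) (f w) = inner ℝ v (Q w) - ∑ i, η i v * η i w) :
    (∀ i v, η i v = inner ℝ v (ξ i)) ∧ IsLinearWeakF f Q ξ ∧
      LinearIndependent ℝ ξ ∧ Submodule.span ℝ (Set.range ξ) = LinearMap.ker f := by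
  have hli : LinearIndependent ℝ ξ := by
    rw [Fintype.linearIndependent_iff]
    intro c hc j
    simpa [hηξ] using congrArg (η j) hc
  have hker : finrank ℝ (LinearMap.ker f) = s := by
    have := LinearMap.finrank_range_add_finrank_ker f
    omega
  have hspan : LinearMap.ker f = Submodule.span ℝ (Set.range ξ) := by
    refine Submodule.eq_of_le_of_finrank_eq ?_ ?_
    · intro v hv
      have h1 := hff v
      rw [LinearMap.mem_ker.1 hv, map_zero, eq_comm, neg_add_eq_zero] at h1
      have h2 : v = ∑ i, η i v • ξ i := hQ.1 (by rw [h1]; simp [hQξ])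
      rw [h2]
      exact Submodule.sum_mem _ fun i _ ↦ Submodule.smul_mem _ _ (Submodule.subset_span ⟨i, rfl⟩)
    · rw [hker, finrank_span_eq_card hli, Fintype.card_fin]
  have hfξ (i) : f (ξ i) = 0 := by
    rw [← LinearMap.mem_ker, hspan]
    exact Submodule.subset_span ⟨i, rfl⟩
  have hη (i v) : η i v = inner ℝ v (ξ i) := by
    have := hfg v (ξ i)
    rw [hfξ, inner_zero_right, hQξ] at this
    simp only [hηξ, mul_ite, mul_one, mul_zero, Finset.sum_ite_eq', Finset.mem_univ, if_true] at this
    linarith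
  have hηQ (j v) : η j (Q v) = η j v := by
    have := hfg (ξ j) v
    rw [hfξ, inner_zero_left, real_inner_comm, ← hη] at this
    simp only [hηξ, ite_mul, one_mul, zero_mul, Finset.sum_ite_eq',
      Finset.mem_univ, if_true] at this
    linarith
  have hηff (j v) : η j (f (f v)) = 0 := by
    rw [hff]
    simp [hηξ, hηQ]
  have hkerff {v} (hv : f (f v) = 0) : f v = 0 := by
    have h1 := hff v
    rw [hv, eq_comm, neg_add_eq_zero] at h1
    have h2 : v = ∑ i, η i v • ξ i := hQ.1 (by rw [h1]; simp [hQξ])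
    rw [h2]
    simp [hfξ]
  -- η j vanishes on the range of f², which is all of the range of f because the kernels of f and f²
  -- agree.
  have hηf (j v) : η j (f v) = 0 := by
    have h1 : LinearMap.range (f ∘ₗ f) = LinearMap.range f := by
      refine Submodule.eq_of_le_of_finrank_eq (LinearMap.range_comp_le_range f f) ?_
      have h2 : LinearMap.ker (f ∘ₗ f) = LinearMap.ker f :=
        le_antisymm (fun v hv ↦ hkerff hv) (LinearMap.ker_le_ker_comp f f)
      have h3 := LinearMap.finrank_range_add_finrank_ker f
      have h4 := LinearMap.finrank_range_add_finrank_ker (f ∘ₗ f)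
      rw [h2] at h4
      omega
    obtain ⟨u, hu⟩ : f v ∈ LinearMap.range (f ∘ₗ f) := h1 ▸ LinearMap.mem_range_self f v
    rw [← hu]
    exact hηff j u
  refine ⟨hη, ⟨fun i j ↦ ?_, fun v ↦ ?_, fun v w ↦ ?_, hfξ, hQξ, hQ⟩, hli, hspan.symm⟩
  · rw [← hη, hηξ]
    simp only [eq_comm]
  · rw [hff]
    simp only [hη]
  · obtain ⟨u, rfl⟩ := hQ.2 w
    have h1 := hfg (f v) (f u)
    have h2 := hfg v u
    have h3 (v) : Q v = ∑ i, η i v • ξ i - f (f v) := by rw [hff]; abel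
    have h4 : Q (f u) = -f (f (f u)) := by rw [h3]; simp [hηf]
    have h5 : f (Q u) = -f (f (f u)) := by rw [h3]; simp [hfξ]
    have h6 := hfg v (f u)
    simp only [hηf, mul_zero, Finset.sum_const_zero, sub_zero] at h6
    rw [h5, ← h4, ← h6, h3]
    rw [inner_sub_right, inner_sum, Finset.sum_eq_zero, zero_sub]
    intro i _
    rw [inner_smul_right, ← hη, hηf, mul_zero]

end LinearWeakF

/-! ### The geometric hypotheses as pointwise relations. -/

namespace FramedWeakFStructure

variable {E : Type*} [NormedAddCommGroup E] [NormedSpace ℝ E] [FiniteDimensional ℝ E]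
  {H : Type*} [TopologicalSpace H] {I : ModelWithCorners ℝ E H}
  {M : Type*} [TopologicalSpace M] [T2Space M] [ChartedSpace H M] [IsManifold I ∞ M]
  [RiemannianBundle (fun x : M ↦ TangentSpace I x)]
  [IsContMDiffRiemannianBundle I ∞ E (fun x : M ↦ TangentSpace I x)]
  {n s : ℕ} {𝒮 : FramedWeakFStructure I M n s}

theorem algebra (hg : 𝒮.IsCompatibleMetric) (x : M) :
    (∀ i v, 𝒮.η i x v = inner ℝ v (𝒮.ξ i x)) ∧
      IsLinearWeakF (𝒮.f x).toLinearMap (𝒮.Q x).toLinearMap (fun i ↦ 𝒮.ξ i x) ∧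
      LinearIndependent ℝ (fun i ↦ 𝒮.ξ i x) ∧
      Submodule.span ℝ (Set.range fun i ↦ 𝒮.ξ i x) = (𝒮.f x).ker :=
  haveI : FiniteDimensional ℝ (TangentSpace I x) :=
    VectorBundle.finiteDimensional ℝ E (fun x : M ↦ TangentSpace I x) x
  isLinearWeakF_of_rank (η := fun i ↦ (𝒮.η i x).toLinearMap) 𝒮.dim_eq (𝒮.rank_f x)
    (𝒮.nonsingular_Q x) (𝒮.f_sq x) (fun i j ↦ 𝒮.η_ξ i j x) (fun i ↦ 𝒮.Q_ξ i x) (hg x)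

theorem η_eq (hg : 𝒮.IsCompatibleMetric) (i : Fin s) (x : M) (v : TangentSpace I x) :
    𝒮.η i x v = inner ℝ v (𝒮.ξ i x) := (algebra hg x).1 i v

theorem linear (hg : 𝒮.IsCompatibleMetric) (x : M) :
    IsLinearWeakF (𝒮.f x).toLinearMap (𝒮.Q x).toLinearMap (fun i ↦ 𝒮.ξ i x) := (algebra hg x).2.1

theorem mem_contact_iff (hg : 𝒮.IsCompatibleMetric) {x : M} {v : TangentSpace I x} :
    v ∈ 𝒮.contact x ↔ ∀ i, inner ℝ v (𝒮.ξ i x) = 0 := by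
  simp [contact, η_eq hg]

theorem inner_Q (hg : 𝒮.IsCompatibleMetric) (x : M) (v w : TangentSpace I x) :
    inner ℝ (𝒮.Q x v) w = inner ℝ v (𝒮.Q x w) := by
  have h1 := hg x v w
  have h2 := hg x w v
  rw [real_inner_comm] at h2
  rw [real_inner_comm w]
  simp only [mul_comm (𝒮.η _ x w)] at h2
  linarith

/-- `∇ξ_i` as a `(1,1)`-tensor. -/
def A (𝒮 : FramedWeakFStructure I M n s) (i : Fin s) (x : M) :
    TangentSpace I x →L[ℝ] TangentSpace I x := leviCivita (𝒮.ξ i) x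

theorem nabla_ξ (i : Fin s) (X : Π x : M, TangentSpace I x) (x : M) :
    nabla X (𝒮.ξ i) x = 𝒮.A i x (X x) := rfl

/-- Since ∇ is metric and torsion-free, 2 dη^i(X, Y) = ⟨∇_X ξ_i, Y⟩ - ⟨∇_Y ξ_i, X⟩. -/
theorem A_sub_adjoint (h𝒮 : 𝒮.IsWeakAlmostS) (i : Fin s) (x : M) (v w : TangentSpace I x) :
    inner ℝ (𝒮.A i x v) w - inner ℝ v (𝒮.A i x w) = 2 * inner ℝ v (𝒮.f x w) := by
  obtain ⟨X, hX, rfl⟩ := exists_contMDiff_eq (I := I) v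
  obtain ⟨Y, hY, rfl⟩ := exists_contMDiff_eq (I := I) w
  have h1 := h𝒮.Φ_eq i X Y hX hY x
  simp only [Φ, extDeriv₁, η_eq h𝒮.compatible] at h1
  have hX' := contMDiff_mdiffAt hX x
  have hY' := contMDiff_mdiffAt hY x
  have hξ' := contMDiff_mdiffAt (𝒮.smooth_ξ i) x
  rw [leviCivita_metric hX' hY' hξ', leviCivita_metric hY' hX' hξ',
    ← leviCivita_torsion hX' hY', inner_sub_left] at h1
  rw [h1, real_inner_comm]
  simp only [A]
  ring

theorem smoothAdjoint_f (hg : 𝒮.IsCompatibleMetric) :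
    IsSmoothAdjoint 𝒮.f (fun x ↦ -𝒮.f x) where
  left X hX := 𝒮.smooth_f.contMDiff_apply hX
  right X hX := (𝒮.smooth_f.contMDiff_apply hX).neg_section
  adjoint x v w := by
    rw [neg_apply, inner_neg_right]
    exact (linear hg x).skew v w

theorem smoothAdjoint_Q (hg : 𝒮.IsCompatibleMetric) : IsSmoothAdjoint 𝒮.Q 𝒮.Q where
  left _ hX := 𝒮.smooth_Q.contMDiff_apply hX
  right _ hX := 𝒮.smooth_Q.contMDiff_apply hX
  adjoint := inner_Q hg

theorem contMDiff_A (i : Fin s) {X : Π x : M, TangentSpace I x} (hX : CMDiff ∞ (T% X)) :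
    CMDiff ∞ (T% (fun y ↦ 𝒮.A i y (X y))) := contMDiff_nabla hX (𝒮.smooth_ξ i)

theorem smoothAdjoint_A (h𝒮 : 𝒮.IsWeakAlmostS) (i : Fin s) :
    IsSmoothAdjoint (𝒮.A i) (fun x ↦ 𝒮.A i x + (2 : ℝ) • 𝒮.f x) where
  left X hX := contMDiff_A i hX
  right X hX := (contMDiff_A i hX).add_section
    ((𝒮.smooth_f.contMDiff_apply hX).const_smul_section (a := (2 : ℝ)))
  adjoint x v w := by
    have := A_sub_adjoint h𝒮 i x v w
    rw [add_apply, smul_apply, inner_add_right, inner_smul_right]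
    linarith

theorem nablaEndo_adjoint_A (i : Fin s) {X Y : Π x : M, TangentSpace I x}
    (hY : CMDiff ∞ (T% Y)) (x : M) :
    nablaEndo (fun x ↦ 𝒮.A i x + (2 : ℝ) • 𝒮.f x) X Y x =
      nablaEndo (𝒮.A i) X Y x + (2 : ℝ) • nablaEndo 𝒮.f X Y x := by
  have h1 := contMDiff_mdiffAt (contMDiff_A (𝒮 := 𝒮) i hY) x
  have h2 := contMDiff_mdiffAt (𝒮.smooth_f.contMDiff_apply hY) x
  have h3 : MDiffAt (T% ((2 : ℝ) • fun y ↦ 𝒮.f y (Y y))) x :=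
    contMDiff_mdiffAt ((𝒮.smooth_f.contMDiff_apply hY).const_smul_section (a := (2 : ℝ))) x
  have e : (fun y ↦ (𝒮.A i y + (2 : ℝ) • 𝒮.f y) (Y y)) =
      (fun y ↦ 𝒮.A i y (Y y)) + (2 : ℝ) • fun y ↦ 𝒮.f y (Y y) := rfl
  simp only [nablaEndo]
  rw [e, nabla_add h1 h3, nabla_const_smul _ h2, add_apply, smul_apply]
  module

theorem nablaEndo_neg_f {X Y : Π x : M, TangentSpace I x} (hY : CMDiff ∞ (T% Y)) (x : M) :
    nablaEndo (fun x ↦ -𝒮.f x) X Y x = -nablaEndo 𝒮.f X Y x := by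
  have h2 := contMDiff_mdiffAt (𝒮.smooth_f.contMDiff_apply hY) x
  have e : (fun y ↦ (-𝒮.f y) (Y y)) = -fun y ↦ 𝒮.f y (Y y) := rfl
  simp only [nablaEndo]
  rw [e, nabla_neg h2, neg_apply]
  abel

/-- Absence of torsion identifies R_{X,Y} ξ_i with the difference of the two sides. -/
theorem codazzi (hR : 𝒮.ReebCurvatureZero) (i : Fin s) {X Y : Π x : M, TangentSpace I x}
    (hX : CMDiff ∞ (T% X)) (hY : CMDiff ∞ (T% Y)) (x : M) :
    nablaEndo (𝒮.A i) X Y x = nablaEndo (𝒮.A i) Y X x := by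
  have h1 := hR X Y hX hY i x
  have h2 : nabla (mlieBracket I X Y) (𝒮.ξ i) x = 𝒮.A i x (nabla X Y x - nabla Y X x) := by
    rw [nabla_ξ, ← leviCivita_torsion (contMDiff_mdiffAt hX x) (contMDiff_mdiffAt hY x)]
    rfl
  rw [curvature, h2, map_sub] at h1
  rw [← sub_eq_zero, ← h1]
  simp only [nablaEndo]
  change _ = nabla X (fun y ↦ 𝒮.A i y (Y y)) x - nabla Y (fun y ↦ 𝒮.A i y (X y)) x - _
  abel

theorem A_skew (hg : 𝒮.IsCompatibleMetric) (i j : Fin s) (x : M) (v : TangentSpace I x) :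
    inner ℝ (𝒮.A i x v) (𝒮.ξ j x) = -inner ℝ (𝒮.ξ i x) (𝒮.A j x v) := by
  obtain ⟨X, hX, rfl⟩ := exists_contMDiff_eq (I := I) v
  have h1 := leviCivita_metric (contMDiff_mdiffAt hX x) (contMDiff_mdiffAt (𝒮.smooth_ξ i) x)
    (contMDiff_mdiffAt (𝒮.smooth_ξ j) x)
  have e : (fun y ↦ inner ℝ (𝒮.ξ i y) (𝒮.ξ j y)) = fun _ ↦ if i = j then (1 : ℝ) else 0 :=
    funext fun y ↦ (linear hg y).orthonormal i j
  rw [e, mvfderiv_const] at h1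
  simp only [zero_apply] at h1
  simp only [A]
  linarith

theorem nablaEndo_f_ξ (hg : 𝒮.IsCompatibleMetric) (j : Fin s) (X : Π x : M, TangentSpace I x)
    (x : M) : nablaEndo 𝒮.f X (𝒮.ξ j) x = -𝒮.f x (𝒮.A j x (X x)) := by
  have e : (fun y ↦ 𝒮.f y (𝒮.ξ j y)) = 0 := funext fun y ↦ (linear hg y).f_ξ j
  rw [nablaEndo, e, nabla_zero, zero_sub, nabla_ξ]

theorem nablaEndo_Q_ξ (j : Fin s) (X : Π x : M, TangentSpace I x) (x : M) :
    nablaEndo 𝒮.Q X (𝒮.ξ j) x = 𝒮.A j x (X x) - 𝒮.Q x (𝒮.A j x (X x)) := by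
  have e : (fun y ↦ 𝒮.Q y (𝒮.ξ j y)) = 𝒮.ξ j := funext fun y ↦ 𝒮.Q_ξ j y
  rw [nablaEndo, e, nabla_ξ]

theorem lieDerivEndo_eq {S : Π x : M, TangentSpace I x →L[ℝ] TangentSpace I x} (i : Fin s)
    {X : Π x : M, TangentSpace I x} {x : M} (hX : MDiffAt (T% X) x)
    (hSX : MDiffAt (T% (fun y ↦ S y (X y))) x) :
    lieDerivEndo (𝒮.ξ i) S X x =
      nablaEndo S (𝒮.ξ i) X x + S x (𝒮.A i x (X x)) - 𝒮.A i x (S x (X x)) := by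
  have hξ := contMDiff_mdiffAt (𝒮.smooth_ξ i) x
  rw [lieDerivEndo, ← leviCivita_torsion hξ hX, ← leviCivita_torsion hξ hSX, map_sub]
  simp only [nablaEndo, nabla, A]
  abel

theorem h_apply (i : Fin s) {X : Π x : M, TangentSpace I x} {x : M} (hX : MDiffAt (T% X) x) :
    (2 : ℝ) • 𝒮.h i x (X x) =
      nablaEndo 𝒮.f (𝒮.ξ i) X x + 𝒮.f x (𝒮.A i x (X x)) - 𝒮.A i x (𝒮.f x (X x)) := by
  rw [← lieDerivEndo_eq i hX (𝒮.smooth_f.mdiffAt_apply hX), h, lieDerivTensor, smul_apply,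
    TensorialAt.mkHom_apply _ hX, smul_smul]
  norm_num

theorem nablaEndo_f_f (hg : 𝒮.IsCompatibleMetric) {X Y : Π x : M, TangentSpace I x}
    (hX : CMDiff ∞ (T% X)) (hY : CMDiff ∞ (T% Y)) (x : M) :
    nablaEndo 𝒮.f X (fun y ↦ 𝒮.f y (Y y)) x + 𝒮.f x (nablaEndo 𝒮.f X Y x) =
      -nablaEndo 𝒮.Q X Y x + ∑ i, (inner ℝ (Y x) (𝒮.A i x (X x)) • 𝒮.ξ i x +
        inner ℝ (Y x) (𝒮.ξ i x) • 𝒮.A i x (X x)) := by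
  have hYξ (i) : CMDiff ∞ (fun y ↦ inner ℝ (Y y) (𝒮.ξ i y)) := contMDiff_inner hY (𝒮.smooth_ξ i)
  have hs (i) : CMDiff ∞ (T% ((fun y ↦ inner ℝ (Y y) (𝒮.ξ i y)) • 𝒮.ξ i)) :=
    (hYξ i).smul_section (𝒮.smooth_ξ i)
  have hQY := 𝒮.smooth_Q.contMDiff_apply hY
  have hQY' : CMDiff ∞ (T% (-fun y ↦ 𝒮.Q y (Y y))) := hQY.neg_section
  have hsum : CMDiff ∞ (T% (fun y ↦ ∑ i, ((fun y ↦ inner ℝ (Y y) (𝒮.ξ i y)) • 𝒮.ξ i) y)) :=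
    ContMDiff.sum_section fun i _ ↦ hs i
  have e : (fun y ↦ 𝒮.f y (𝒮.f y (Y y))) = (-fun y ↦ 𝒮.Q y (Y y)) +
      fun y ↦ ∑ i, ((fun y ↦ inner ℝ (Y y) (𝒮.ξ i y)) • 𝒮.ξ i) y :=
    funext fun y ↦ (linear hg y).f_sq (Y y)
  have h1 := nablaEndo_comp 𝒮.f 𝒮.f X Y x
  have h2 (i) : d% (fun y ↦ inner ℝ (Y y) (𝒮.ξ i y)) x (X x) =
      inner ℝ (nabla X Y x) (𝒮.ξ i x) + inner ℝ (Y x) (𝒮.A i x (X x)) :=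
    leviCivita_metric (contMDiff_mdiffAt hX x) (contMDiff_mdiffAt hY x)
      (contMDiff_mdiffAt (𝒮.smooth_ξ i) x)
  have h3 (i) : nabla X ((fun y ↦ inner ℝ (Y y) (𝒮.ξ i y)) • 𝒮.ξ i) x =
      (inner ℝ (Y x) (𝒮.A i x (X x)) • 𝒮.ξ i x + inner ℝ (Y x) (𝒮.ξ i x) • 𝒮.A i x (X x)) +
        inner ℝ (nabla X Y x) (𝒮.ξ i x) • 𝒮.ξ i x := by
    rw [nabla_smul ((hYξ i x).mdifferentiableAt (by simp)) (contMDiff_mdiffAt (𝒮.smooth_ξ i) x),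
      h2, nabla_ξ]
    module
  rw [e, nabla_add (contMDiff_mdiffAt hQY' x) (contMDiff_mdiffAt hsum x),
    nabla_neg (contMDiff_mdiffAt hQY x), nabla_sum _ hs] at h1
  simp only [h3] at h1
  have h4 : 𝒮.f x (𝒮.f x (nabla X Y x)) = -𝒮.Q x (nabla X Y x) +
      ∑ i, inner ℝ (nabla X Y x) (𝒮.ξ i x) • 𝒮.ξ i x := (linear hg x).f_sq _
  rw [h4, Finset.sum_add_distrib] at h1
  rw [nablaEndo.eq_def 𝒮.Q]
  linear_combination (norm := module) -h1

/-- Every covariant derivative involved is tensorial, so each relation between vectors at x is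
tested on smooth extensions of them. -/
theorem exists_isReebFlat (h𝒮 : 𝒮.IsWeakAlmostS) (hR : 𝒮.ReebCurvatureZero)
    (hQ : 𝒮.ReebPreservesQ) (x : M) :
    ∃ (F P : TangentSpace I x →ₗ[ℝ] TangentSpace I x →ₗ[ℝ] TangentSpace I x)
      (G : Fin s → TangentSpace I x →ₗ[ℝ] TangentSpace I x →ₗ[ℝ] TangentSpace I x),
      IsReebFlat (𝒮.f x).toLinearMap (𝒮.Q x).toLinearMap (fun i ↦ 𝒮.ξ i x)
        (fun i ↦ (𝒮.A i x).toLinearMap) F P G ∧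
      (∀ X Y : Π x : M, TangentSpace I x, CMDiff ∞ (T% X) → CMDiff ∞ (T% Y) →
        nablaEndo 𝒮.f X Y x = F (X x) (Y x)) ∧
      (∀ X Y : Π x : M, TangentSpace I x, CMDiff ∞ (T% X) → CMDiff ∞ (T% Y) →
        nablaEndo 𝒮.Q X Y x = P (X x) (Y x)) ∧
      (∀ i, ∀ X Y : Π x : M, TangentSpace I x, CMDiff ∞ (T% X) → CMDiff ∞ (T% Y) →
        nablaEndo (𝒮.A i) X Y x = G i (X x) (Y x)) := by
  have hg := h𝒮.compatible
  obtain ⟨F, hF⟩ := exists_nablaEndo_eq (smoothAdjoint_f hg) x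
  obtain ⟨P, hP⟩ := exists_nablaEndo_eq (smoothAdjoint_Q hg) x
  choose G hG using fun i ↦ exists_nablaEndo_eq (smoothAdjoint_A h𝒮 i) x
  choose ext hs hext using fun v : TangentSpace I x ↦ exists_contMDiff_eq (I := I) v
  have hff (v) := 𝒮.smooth_f.contMDiff_apply (hs v)
  refine ⟨F, P, G, ⟨linear hg x, ?_, ?_, ?_, ?_, ?_, ?_, ?_, ?_⟩, hF, hP, hG⟩
  · exact fun i v w ↦ A_sub_adjoint h𝒮 i x v w
  · intro i v w
    have := codazzi hR i (hs v) (hs w) x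
    simpa only [hG i _ _ (hs _) (hs _), hext] using this
  · intro i v w z
    have := inner_nablaEndo (smoothAdjoint_A h𝒮 i) (hs v) (hs w) (hs z) x
    rw [nablaEndo_adjoint_A i (hs z), inner_add_right, inner_smul_right] at this
    simp only [hG i _ _ (hs _) (hs _), hF _ _ (hs _) (hs _), hext] at this
    linarith
  · intro v w z
    have := inner_nablaEndo (smoothAdjoint_f hg) (hs v) (hs w) (hs z) x
    rw [nablaEndo_neg_f (hs z), inner_neg_right] at this
    simpa only [hF _ _ (hs _) (hs _), hext] using this
  · exact fun i j v ↦ A_skew hg i j x v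
  · intro j v
    have := nablaEndo_f_ξ hg j (ext v) x
    simp only [hF _ _ (hs _) (𝒮.smooth_ξ j), hext] at this
    exact this
  · intro i v
    have := hQ i (ext v) (hs v) x
    rw [lieDerivEndo_eq i (contMDiff_mdiffAt (hs v) x)
      (contMDiff_mdiffAt (𝒮.smooth_Q.contMDiff_apply (hs v)) x)] at this
    simp only [hP _ _ (𝒮.smooth_ξ i) (hs _), hext] at this
    exact this
  · intro v w
    have := nablaEndo_f_f hg (hs v) (hs w) x
    simp only [hP _ _ (hs _) (hs _), hF _ _ (hs _) (hs _), hF _ _ (hs _) (hff _), hext] at this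
    exact this

end FramedWeakFStructure

/-! ### Smooth distributions. -/

section Distribution

variable {E : Type*} [NormedAddCommGroup E] [NormedSpace ℝ E] [FiniteDimensional ℝ E]
  {H : Type*} [TopologicalSpace H] {I : ModelWithCorners ℝ E H}
  {M : Type*} [TopologicalSpace M] [T2Space M] [ChartedSpace H M] [IsManifold I ∞ M]

/-- Continuous fields that are linearly independent at a point are so near that point. -/
theorem eventually_linearIndependent {k : ℕ} {e : Fin k → Π x : M, TangentSpace I x}
    (he : ∀ a, CMDiff ∞ (T% (e a))) {x : M} (hx : LinearIndependent ℝ (fun a ↦ e a x)) :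
    ∀ᶠ y in 𝓝 x, LinearIndependent ℝ (fun a ↦ e a y) := by
  let t := trivializationAt E (fun x : M ↦ TangentSpace I x) x
  have hxt : x ∈ t.baseSet := FiberBundle.mem_baseSet_trivializationAt' x
  have hc : ContinuousAt (fun y a ↦ (t (T% (e a) y)).2) x := by
    refine continuousAt_pi.2 fun a ↦ ?_
    exact ((contMDiffAt_section (F := E) (IB := I) (E := fun x : M ↦ TangentSpace I x) x).1
      (he a x)).continuousAt
  have hli {y} (hy : y ∈ t.baseSet) : LinearIndependent ℝ (fun a ↦ (t (T% (e a) y)).2) ↔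
      LinearIndependent ℝ (fun a ↦ e a y) := by
    rw [← LinearMap.linearIndependent_iff (t.linearEquivAt ℝ y hy).toLinearMap
      (LinearEquiv.ker _)]
    rfl
  filter_upwards [hc.eventually (isOpen_setOfPred_linearIndependent.mem_nhds ((hli hxt).2 hx)),
    t.open_baseSet.mem_nhds hxt] with y h1 h2
  exact (hli h2).1 h1

/-- A distribution of rank `k` is smooth if some endomorphism preserving smoothness maps into it
and is injective on it. -/
theorem isSmoothDistribution_of_endo {k : ℕ} {D : Π x : M, Submodule ℝ (TangentSpace I x)}
    (hD : ∀ x, finrank ℝ (D x) = k) {L : Π x : M, TangentSpace I x → TangentSpace I x}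
    (hL : ∀ X : Π x : M, TangentSpace I x, CMDiff ∞ (T% X) → CMDiff ∞ (T% (fun y ↦ L y (X y))))
    (hLD : ∀ x v, L x v ∈ D x)
    (hinj : ∀ x, ∃ B : TangentSpace I x →ₗ[ℝ] TangentSpace I x, LinearMap.ker B = ⊥ ∧
      ∀ v ∈ D x, L x v = B v) : IsSmoothDistribution k D := by
  intro x
  have hfin (y : M) : FiniteDimensional ℝ (TangentSpace I y) :=
    VectorBundle.finiteDimensional ℝ E (fun x : M ↦ TangentSpace I x) y
  -- A basis of D x is extended to arbitrary smooth fields and L pushes them into D. Independence at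
  -- x persists nearby, and the rank forces them to span.
  let b := Module.finBasisOfFinrankEq ℝ (D x) (hD x)
  choose X hX hXx using fun a ↦ exists_contMDiff_eq (I := I) (b a : TangentSpace I x)
  obtain ⟨B, hB, hBL⟩ := hinj x
  have hli : LinearIndependent ℝ (fun a ↦ L x (X a x)) := by
    have h1 : LinearIndependent ℝ (fun a ↦ (b a : TangentSpace I x)) :=
      b.linearIndependent.map' (D x).subtype (Submodule.ker_subtype _)
    have h2 : (fun a ↦ L x (X a x)) = B ∘ fun a ↦ (b a : TangentSpace I x) := by
      funext a
      rw [hXx, hBL _ (b a).2]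
      rfl
    rw [h2]
    exact h1.map' B hB
  obtain ⟨U, hU, hUo, hxU⟩ := eventually_nhds_iff.1
    (eventually_linearIndependent (fun a ↦ hL _ (hX a)) hli)
  refine ⟨U, hUo, hxU, fun a y ↦ L y (X a y), fun a ↦ (hL _ (hX a)).contMDiffOn, fun y hy ↦
    ⟨hU y hy, ?_⟩⟩
  refine Submodule.eq_of_le_of_finrank_eq (Submodule.span_le.2 ?_) ?_
  · rintro _ ⟨a, rfl⟩
    exact hLD y _
  · rw [finrank_span_eq_card (hU y hy), Fintype.card_fin, hD]

end Distribution

/-! ### Differentiating the pointwise identities; the tensors h̃_i and ∇Φ. -/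

namespace FramedWeakFStructure

variable {E : Type*} [NormedAddCommGroup E] [NormedSpace ℝ E] [FiniteDimensional ℝ E]
  {H : Type*} [TopologicalSpace H] {I : ModelWithCorners ℝ E H}
  {M : Type*} [TopologicalSpace M] [T2Space M] [ChartedSpace H M] [IsManifold I ∞ M]
  [RiemannianBundle (fun x : M ↦ TangentSpace I x)]
  [IsContMDiffRiemannianBundle I ∞ E (fun x : M ↦ TangentSpace I x)]
  {n s : ℕ} {𝒮 : FramedWeakFStructure I M n s}

theorem Q_Qinv (x : M) (v : TangentSpace I x) : 𝒮.Q x (𝒮.Qinv x v) = v := by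
  have hfin : FiniteDimensional ℝ (TangentSpace I x) :=
    VectorBundle.finiteDimensional ℝ E (fun x : M ↦ TangentSpace I x) x
  let e := (LinearEquiv.ofBijective (𝒮.Q x).toLinearMap (𝒮.nonsingular_Q x)).toContinuousLinearEquiv
  have he : 𝒮.Q x = (e : TangentSpace I x →L[ℝ] TangentSpace I x) := by ext; rfl
  rw [Qinv, he, ContinuousLinearMap.inverse_equiv]
  exact e.apply_symm_apply v

variable (h𝒮 : 𝒮.IsWeakAlmostS) (hR : 𝒮.ReebCurvatureZero) (hQ : 𝒮.ReebPreservesQ)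
include h𝒮 hR hQ

theorem A_f (i : Fin s) (x : M) (v : TangentSpace I x) :
    𝒮.A i x (𝒮.f x v) + 𝒮.f x (𝒮.A i x v) + (2 : ℝ) • 𝒮.f x (𝒮.f x v) = 0 := by
  obtain ⟨F, P, G, h, -⟩ := exists_isReebFlat h𝒮 hR hQ x
  exact h.A_f i v

theorem A_ξ (i j : Fin s) (x : M) : 𝒮.A i x (𝒮.ξ j x) = 0 := by
  obtain ⟨F, P, G, h, -⟩ := exists_isReebFlat h𝒮 hR hQ x
  exact h.A_ξ i j

theorem nablaEndo_A_ξ (i j : Fin s) (X : Π x : M, TangentSpace I x) (x : M) :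
    nablaEndo (𝒮.A i) X (𝒮.ξ j) x = -𝒮.A i x (𝒮.A j x (X x)) := by
  have e : (fun y ↦ 𝒮.A i y (𝒮.ξ j y)) = 0 := funext fun y ↦ A_ξ h𝒮 hR hQ i j y
  rw [nablaEndo, e, nabla_zero, zero_sub, nabla_ξ]

theorem nablaEndo_A_f (i : Fin s) {X Y : Π x : M, TangentSpace I x}
    (hY : CMDiff ∞ (T% Y)) (x : M) :
    nablaEndo (𝒮.A i) X (fun y ↦ 𝒮.f y (Y y)) x + 𝒮.A i x (nablaEndo 𝒮.f X Y x) +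
      nablaEndo 𝒮.f X (fun y ↦ 𝒮.A i y (Y y)) x + 𝒮.f x (nablaEndo (𝒮.A i) X Y x) +
      (2 : ℝ) • (nablaEndo 𝒮.f X (fun y ↦ 𝒮.f y (Y y)) x + 𝒮.f x (nablaEndo 𝒮.f X Y x)) = 0 := by
  have hfY := 𝒮.smooth_f.contMDiff_apply hY
  have hAfY := contMDiff_A (𝒮 := 𝒮) i hfY
  have hfAY := 𝒮.smooth_f.contMDiff_apply (contMDiff_A (𝒮 := 𝒮) i hY)
  have hffY := 𝒮.smooth_f.contMDiff_apply hfY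
  have hsum : CMDiff ∞ (T% ((fun y ↦ 𝒮.A i y (𝒮.f y (Y y))) + fun y ↦ 𝒮.f y (𝒮.A i y (Y y)))) :=
    hAfY.add_section hfAY
  have hsm : CMDiff ∞ (T% ((2 : ℝ) • fun y ↦ 𝒮.f y (𝒮.f y (Y y)))) :=
    hffY.const_smul_section (a := (2 : ℝ))
  have e : ((fun y ↦ 𝒮.A i y (𝒮.f y (Y y))) + fun y ↦ 𝒮.f y (𝒮.A i y (Y y))) +
      ((2 : ℝ) • fun y ↦ 𝒮.f y (𝒮.f y (Y y))) = 0 := funext fun y ↦ A_f h𝒮 hR hQ i y (Y y)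
  have h0 := nabla_zero X x
  rw [← e, nabla_add (contMDiff_mdiffAt hsum x) (contMDiff_mdiffAt hsm x),
    nabla_add (contMDiff_mdiffAt hAfY x) (contMDiff_mdiffAt hfAY x),
    nabla_const_smul _ (contMDiff_mdiffAt hffY x), nablaEndo_comp, nablaEndo_comp,
    nablaEndo_comp] at h0
  linear_combination (norm := module) h0 - A_f h𝒮 hR hQ i x (nabla X Y x)

/-- The identities `A_ξ` and `A_f` are now known at every point, so their derivatives join the
pointwise data. -/
theorem exists_isReebFlat_deriv (x : M) :
    ∃ (F P : TangentSpace I x →ₗ[ℝ] TangentSpace I x →ₗ[ℝ] TangentSpace I x)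
      (G : Fin s → TangentSpace I x →ₗ[ℝ] TangentSpace I x →ₗ[ℝ] TangentSpace I x),
      IsReebFlat (𝒮.f x).toLinearMap (𝒮.Q x).toLinearMap (fun i ↦ 𝒮.ξ i x)
        (fun i ↦ (𝒮.A i x).toLinearMap) F P G ∧
      (∀ X Y : Π x : M, TangentSpace I x, CMDiff ∞ (T% X) → CMDiff ∞ (T% Y) →
        nablaEndo 𝒮.f X Y x = F (X x) (Y x)) ∧
      (∀ X Y : Π x : M, TangentSpace I x, CMDiff ∞ (T% X) → CMDiff ∞ (T% Y) →
        nablaEndo 𝒮.Q X Y x = P (X x) (Y x)) ∧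
      (∀ i, ∀ X Y : Π x : M, TangentSpace I x, CMDiff ∞ (T% X) → CMDiff ∞ (T% Y) →
        nablaEndo (𝒮.A i) X Y x = G i (X x) (Y x)) ∧
      IsReebFlat.DerivAξ (fun i ↦ 𝒮.ξ i x) (fun i ↦ (𝒮.A i x).toLinearMap) G ∧
      IsReebFlat.DerivAf (𝒮.f x).toLinearMap (fun i ↦ (𝒮.A i x).toLinearMap) F G := by
  obtain ⟨F, P, G, h, hF, hP, hG⟩ := exists_isReebFlat h𝒮 hR hQ x
  choose ext hs hext using fun v : TangentSpace I x ↦ exists_contMDiff_eq (I := I) v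
  refine ⟨F, P, G, h, hF, hP, hG, fun i j v ↦ ?_, fun i v w ↦ ?_⟩
  · have := nablaEndo_A_ξ h𝒮 hR hQ i j (ext v) x
    simp only [hG i _ _ (hs _) (𝒮.smooth_ξ j), hext] at this
    exact this
  · have := nablaEndo_A_f h𝒮 hR hQ i (X := ext v) (hs w) x
    simp only [hG i _ _ (hs _) (hs _), hF _ _ (hs _) (hs _),
      hF _ _ (hs _) (𝒮.smooth_f.contMDiff_apply (hs _)), hF _ _ (hs _) (contMDiff_A i (hs _)),
      hG i _ _ (hs _) (𝒮.smooth_f.contMDiff_apply (hs _)), hext] at this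
    exact this

theorem A_eq (i j : Fin s) : 𝒮.A i = 𝒮.A j := by
  funext x
  obtain ⟨F, P, G, h, -, -, -, h1, h2⟩ := exists_isReebFlat_deriv h𝒮 hR hQ x
  ext v
  exact LinearMap.congr_fun (h.A_eq h1 h2 i j) v

theorem isSplitting (i : Fin s) (x : M) :
    IsSplitting (𝒮.f x).toLinearMap (𝒮.Q x).toLinearMap (fun i ↦ 𝒮.ξ i x)
      ((𝒮.A i x).toLinearMap + (𝒮.f x).toLinearMap) := by
  obtain ⟨F, P, G, h, -, -, -, h1, h2⟩ := exists_isReebFlat_deriv h𝒮 hR hQ x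
  exact h.isSplitting h1 h2 i

/-- As ∇_{ξ_i} f = 0, 2h_i = f A_i - A_i f, and `A_f` turns this into 2f(A_i + f). -/
theorem h_eq (i : Fin s) (x : M) (v : TangentSpace I x) :
    𝒮.h i x v = 𝒮.f x (𝒮.A i x v + 𝒮.f x v) := by
  obtain ⟨F, P, G, h, hF, -⟩ := exists_isReebFlat h𝒮 hR hQ x
  obtain ⟨X, hX, rfl⟩ := exists_contMDiff_eq (I := I) v
  have h1 := h_apply (𝒮 := 𝒮) i (contMDiff_mdiffAt hX x)
  rw [hF _ _ (𝒮.smooth_ξ i) hX, h.F_ξ_left_eq_zero i] at h1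
  have h2 := A_f h𝒮 hR hQ i x (X x)
  rw [map_add]
  linear_combination (norm := module) (1 / 2 : ℝ) • h1 - (1 / 2 : ℝ) • h2

theorem Q_ht (i : Fin s) (x : M) (v : TangentSpace I x) :
    𝒮.Q x (𝒮.ht i x v) = 𝒮.f x (𝒮.A i x v + 𝒮.f x v) := by
  rw [← h_eq h𝒮 hR hQ]
  exact Q_Qinv x _

theorem ht_eq (i j : Fin s) : 𝒮.ht i = 𝒮.ht j := by
  funext x
  ext v
  apply (𝒮.nonsingular_Q x).1
  rw [Q_ht h𝒮 hR hQ, Q_ht h𝒮 hR hQ, A_eq h𝒮 hR hQ i j]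

theorem isSmoothDistribution_eigenDist (i : Fin s) {c : ℝ} (hc : c = 1 ∨ c = -1) :
    IsSmoothDistribution n (eigenDist (𝒮.ht i) c) := by
  have hc0 : c ≠ 0 := by rcases hc with rfl | rfl <;> norm_num
  have hc2 : c ^ 2 = 1 := by rcases hc with rfl | rfl <;> norm_num
  have hfin (y : M) : FiniteDimensional ℝ (TangentSpace I y) :=
    VectorBundle.finiteDimensional ℝ E (fun x : M ↦ TangentSpace I x) y
  -- This map preserves smoothness with no need for a smooth Q⁻¹, and on the eigenspace it equals
  -- the invertible map 2cQ.
  refine isSmoothDistribution_of_endo (L := fun x v ↦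
    𝒮.f x (𝒮.A i x v + 𝒮.f x v) - c • 𝒮.f x (𝒮.f x v)) (fun x ↦ ?_) (fun X hX ↦ ?_)
    (fun x v ↦ ?_) (fun x ↦ ⟨(2 * c) • (𝒮.Q x).toLinearMap, ?_, fun v hv ↦ ?_⟩)
  · have := (isSplitting h𝒮 hR hQ i x).finrank_eigenspace (T := (𝒮.ht i x).toLinearMap)
      (Q_ht h𝒮 hR hQ i x) (𝒮.rank_f x)
    rcases hc with rfl | rfl
    exacts [this.1, this.2]
  · have hf := 𝒮.smooth_f.contMDiff_apply hX
    exact (𝒮.smooth_f.contMDiff_apply ((contMDiff_A i hX).add_section hf)).sub_section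
      ((𝒮.smooth_f.contMDiff_apply hf).const_smul_section (a := c))
  · exact (isSplitting h𝒮 hR hQ i x).sub_mem_eigenspace (T := (𝒮.ht i x).toLinearMap)
      (Q_ht h𝒮 hR hQ i x) hc2 v
  · rw [LinearMap.ker_smul _ _ (by simpa using hc0)]
    exact LinearMap.ker_eq_bot.2 (𝒮.nonsingular_Q x).1
  · exact (isSplitting h𝒮 hR hQ i x).sub_eq_of_mem_eigenspace (T := (𝒮.ht i x).toLinearMap)
      (Q_ht h𝒮 hR hQ i x) hc0 hv

omit hR hQ in
theorem isSmoothDistribution_ker_f : IsSmoothDistribution s (fun x ↦ (𝒮.f x).ker) := fun x ↦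
  ⟨Set.univ, isOpen_univ, Set.mem_univ x, 𝒮.ξ, fun a ↦ (𝒮.smooth_ξ a).contMDiffOn,
    fun y _ ↦ (algebra h𝒮.compatible y).2.2⟩

-- Parallelism of Q is assumed only for fields tangent to 𝒟 everywhere; orthogonal projection
-- produces such extensions.
omit hR hQ in
theorem exists_contMDiff_contact {x : M} {v : TangentSpace I x} (hv : v ∈ 𝒮.contact x) :
    ∃ X : Π x : M, TangentSpace I x, CMDiff ∞ (T% X) ∧ (∀ y, X y ∈ 𝒮.contact y) ∧ X x = v := by
  have hg := h𝒮.compatible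
  obtain ⟨X, hX, rfl⟩ := exists_contMDiff_eq (I := I) v
  rw [mem_contact_iff hg] at hv
  refine ⟨fun y ↦ X y - ∑ i, (inner ℝ (X y) (𝒮.ξ i y) : ℝ) • 𝒮.ξ i y, ?_, fun y ↦ ?_, ?_⟩
  · exact hX.sub_section (ContMDiff.sum_section fun i _ ↦
      (contMDiff_inner hX (𝒮.smooth_ξ i)).smul_section (𝒮.smooth_ξ i))
  · rw [mem_contact_iff hg]
    intro j
    rw [inner_sub_left, (linear hg y).sum_smul_inner_ξ, sub_self]
  · simp [hv]

theorem Q_eq_id (hs : 0 < s) (hP : 𝒮.QParallelOnContact) (x : M) (v : TangentSpace I x) :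
    𝒮.Q x v = v := by
  have hg := h𝒮.compatible
  obtain ⟨F, P, G, h, -, hPe, -⟩ := exists_isReebFlat h𝒮 hR hQ x
  choose ext hs hext using fun v : TangentSpace I x ↦ exists_contMDiff_eq (I := I) v
  refine h.Q_eq_id ‹0 < s› (fun v w z ↦ ?_) (fun j v ↦ ?_) (fun v w hv hw ↦ ?_) v
  · have := inner_nablaEndo (smoothAdjoint_Q hg) (hs v) (hs w) (hs z) x
    simpa only [hPe _ _ (hs _) (hs _), hext] using this
  · have := nablaEndo_Q_ξ (𝒮 := 𝒮) j (ext v) x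
    simp only [hPe _ _ (hs _) (𝒮.smooth_ξ j), hext] at this
    exact this
  · obtain ⟨X, hX, hXc, rfl⟩ := exists_contMDiff_contact h𝒮 ((mem_contact_iff hg).2 hv)
    obtain ⟨Y, hY, hYc, rfl⟩ := exists_contMDiff_contact h𝒮 ((mem_contact_iff hg).2 hw)
    rw [← hPe X Y hX hY]
    exact hP X Y hX hY hXc hYc x

theorem nablaForm_Φ_eq_zero (hs : 0 < s) (hP : 𝒮.QParallelOnContact)
    {X Y Z : Π x : M, TangentSpace I x} (hY : CMDiff ∞ (T% Y)) (hZ : CMDiff ∞ (T% Z)) {x : M}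
    (hXx : X x ∈ 𝒮.contact x) (hYx : Y x ∈ 𝒮.contact x) (hZx : Z x ∈ 𝒮.contact x) :
    nablaForm 𝒮.Φ X Y Z x = 0 := by
  have hg := h𝒮.compatible
  let i : Fin s := ⟨0, hs⟩
  have hL := linear hg x
  have hQ1 := Q_eq_id h𝒮 hR hQ hs hP
  obtain ⟨F, P, G, h, hF, hPe, hG, h1, h2⟩ := exists_isReebFlat_deriv h𝒮 hR hQ x
  choose ext hse hext using fun v : TangentSpace I x ↦ exists_contMDiff_eq (I := I) v
  have hP0 (v w) : P v w = 0 := by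
    rw [← hext v, ← hext w, ← hPe _ _ (hse v) (hse w)]
    simp [nablaEndo, hQ1]
  have hAA (y : M) (v : TangentSpace I y) : 𝒮.A i y (𝒮.A i y v) = 0 := by
    obtain ⟨F, P, G, h, -, -, -, h1, h2⟩ := exists_isReebFlat_deriv h𝒮 hR hQ y
    exact h.A_A h1 h2 i v
  have hGA (v w) : G i v (𝒮.A i x w) + 𝒮.A i x (G i v w) = 0 := by
    have e := nablaEndo_comp (𝒮.A i) (𝒮.A i) (ext v) (ext w) x
    have e' : (fun y ↦ 𝒮.A i y (𝒮.A i y (ext w y))) = 0 := funext fun y ↦ hAA y _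
    rw [e', nabla_zero, hAA, hG i _ _ (hse v) (hse w), hG i _ _ (hse v) (contMDiff_A i (hse w)),
      hext, hext, add_zero] at e
    exact e.symm
  have hadj (v w) : inner ℝ (𝒮.A i x v) w = inner ℝ v (𝒮.A i x w + (2 : ℝ) • 𝒮.f x w) :=
    (smoothAdjoint_A h𝒮 i).adjoint x v w
  have hf (v w) : inner ℝ (𝒮.f x v) w = -inner ℝ v (𝒮.f x w) := hL.skew v w
  have hFa (v w z) : 2 * inner ℝ (F v w) z = inner ℝ (G i v z) w - inner ℝ (G i v w) z := by
    have e1 := h.G_sub_adjoint i v z w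
    have e3 := real_inner_comm z (F v w)
    have e4 := real_inner_comm z (G i v w)
    linarith
  have key {x' y z : TangentSpace I x} (hx : x' ∈ 𝒮.contact x) (hy : y ∈ 𝒮.contact x)
      (hz : z ∈ 𝒮.contact x) : inner ℝ (G i x' y) z = 0 := by
    refine trilinear_eq_zero (W := 𝒮.contact x) (f := (𝒮.f x).toLinearMap)
      (A := (𝒮.A i x).toLinearMap) (a := fun x' y z ↦ inner ℝ (G i x' y) z)
      (fun _ _ _ _ ↦ ?_) (fun _ _ _ _ ↦ ?_) (fun _ _ _ _ ↦ ?_) (fun _ _ _ _ ↦ ?_)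
      (fun _ _ _ _ ↦ ?_) (fun v ↦ ?_) (fun v hv ↦ ?_) (h.A_f i) (hAA x) (fun v ↦ ?_)
      (fun u v w ↦ ?_) (fun u v w ↦ ?_) (fun u hu v hv w hw ↦ ?_) hx hy hz
    · simp [inner_add_left]
    · simp [inner_add_left]
    · simp [inner_add_right]
    · simp [inner_smul_left]
    · simp [inner_smul_right]
    · exact (mem_contact_iff hg).2 (hL.inner_f_ξ v)
    · have := hL.Q_eq ((mem_contact_iff hg).1 hv)
      rw [← neg_eq_iff_eq_neg.2 this]
      exact congrArg Neg.neg (hQ1 x v)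
    · exact (mem_contact_iff hg).2 fun j ↦ h.inner_A_ξ i j v
    · simp only [h.codazzi i u v]
    · have := congrArg (fun t ↦ inner ℝ t w) (hGA u v)
      simp only [inner_add_left, hadj, inner_zero_left] at this
      exact this
    -- The derivative of A f + f A + 2f² = 0 is paired with w. The f² part drops out on 𝒟 since ∇Q =
    -- 0, and `hFa` rewrites ∇f through ∇A; the terms with A v in the middle slot cancel by ∇(A²) =
    -- 0.
    · have e1 := congrArg (fun t ↦ inner ℝ t w) (h2 i u v)
      have e2 : inner ℝ (F u (𝒮.f x v) + 𝒮.f x (F u v)) w = 0 := by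
        have := h.F_f u v
        simp only [hP0, neg_zero, zero_add] at this
        erw [this]
        rw [sum_inner]
        refine Finset.sum_eq_zero fun j _ ↦ ?_
        rw [mem_contact_iff hg] at hv hw
        rw [inner_add_left, inner_smul_left, inner_smul_left, real_inner_comm w, hv, hw]
        simp
      have e3 := congrArg (fun t ↦ inner ℝ t w) (hGA u v)
      have e4 := hFa u v (𝒮.A i x w + (2 : ℝ) • 𝒮.f x w)
      have e5 := hFa u (𝒮.A i x v) w
      simp only [ContinuousLinearMap.coe_coe] at e1 ⊢
      simp only [inner_add_left, hadj, inner_zero_left, inner_smul_left] at e1 e2 e3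
      rw [hf] at e1
      simp at e1
      linarith
  have e : nablaForm 𝒮.Φ X Y Z x = inner ℝ (Y x) (nablaEndo 𝒮.f X Z x) :=
    nablaForm_eq (smoothAdjoint_f hg) hY hZ x
  have e2 : nablaEndo 𝒮.f X Z x = F (X x) (Z x) := by
    rw [← hext (X x), ← hF _ _ (hse _) hZ]
    simp [nablaEndo, nabla, hext]
  have e3 := h.G_sub_adjoint i (X x) (Y x) (Z x)
  rw [key hXx hYx hZx, real_inner_comm, key hXx hZx hYx] at e3
  rw [e, e2]
  linarith

end FramedWeakFStructure

end WeakF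

end

/-! ### Assembly of the theorem. -/

theorem mainTheorem5 {n s : ℕ} (hn : 0 < n) (hs : 0 < s)
    {E : Type*} [NormedAddCommGroup E] [NormedSpace ℝ E] [FiniteDimensional ℝ E]
    {M : Type*} [TopologicalSpace M] [T2Space M] [SecondCountableTopology M] [ChartedSpace E M]
    [IsManifold 𝓘(ℝ, E) ∞ M]
    [RiemannianBundle (fun x : M ↦ TangentSpace 𝓘(ℝ, E) x)]
    [IsContMDiffRiemannianBundle 𝓘(ℝ, E) ∞ E (fun x : M ↦ TangentSpace 𝓘(ℝ, E) x)]
    (𝒮 : WeakF.FramedWeakFStructure 𝓘(ℝ, E) M n s) (h𝒮 : 𝒮.IsWeakAlmostS)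
    (hR : 𝒮.ReebCurvatureZero) (hQ : 𝒮.ReebPreservesQ) :
    ∃ h : Π x : M, TangentSpace 𝓘(ℝ, E) x →L[ℝ] TangentSpace 𝓘(ℝ, E) x,
      -- all the tensors `Q⁻¹ h_i` coincide with `h`, whose eigenvalues are `0, 1, -1`
      (∀ i, 𝒮.ht i = h) ∧
      (∀ (x : M) (μ : ℝ), Module.End.HasEigenvalue (h x).toLinearMap μ ↔
        μ = 0 ∨ μ = 1 ∨ μ = -1) ∧
      -- the three eigen-distributions and the orthogonal splitting
      (∀ x, WeakF.eigenDist h 0 x = (𝒮.f x).ker) ∧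
      WeakF.IsSmoothDistribution s (fun x ↦ (𝒮.f x).ker) ∧
      WeakF.IsSmoothDistribution n (WeakF.eigenDist h 1) ∧
      WeakF.IsSmoothDistribution n (WeakF.eigenDist h (-1)) ∧
      (∀ x, (𝒮.f x).ker ⟂ WeakF.eigenDist h 1 x ∧ (𝒮.f x).ker ⟂ WeakF.eigenDist h (-1) x ∧
        WeakF.eigenDist h 1 x ⟂ WeakF.eigenDist h (-1) x) ∧
      (∀ x, WeakF.eigenDist h 1 x ⊔ WeakF.eigenDist h (-1) x = 𝒮.contact x) ∧
      (∀ x, (𝒮.f x).ker ⊔ WeakF.eigenDist h 1 x ⊔ WeakF.eigenDist h (-1) x = ⊤) ∧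
      (∀ x, (WeakF.eigenDist h 1 x).map (𝒮.f x).toLinearMap = WeakF.eigenDist h (-1) x ∧
        (WeakF.eigenDist h (-1) x).map (𝒮.f x).toLinearMap = WeakF.eigenDist h 1 x) ∧
      -- the covariant derivative of `Φ`
      (𝒮.QParallelOnContact →
        ∀ X Y Z : Π x : M, TangentSpace 𝓘(ℝ, E) x,
          CMDiff ∞ (T% X) → CMDiff ∞ (T% Y) → CMDiff ∞ (T% Z) → ∀ x : M,
          letI hX := WeakF.applyEndo h X
          letI hY := WeakF.applyEndo h Y
          letI hZ := WeakF.applyEndo h Z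
          letI qX := WeakF.applyEndo 𝒮.Qt X
          letI qY := WeakF.applyEndo 𝒮.Qt Y
          letI qZ := WeakF.applyEndo 𝒮.Qt Z
          letI qhX := WeakF.applyEndo 𝒮.Qt hX
          (X x ∈ 𝒮.contact x → Y x ∈ 𝒮.contact x → Z x ∈ 𝒮.contact x →
            4 * WeakF.nablaForm 𝒮.Φ hX Y Z x =
              WeakF.nablaForm 𝒮.Φ qY Z hX x + WeakF.nablaForm 𝒮.Φ qY hZ X x
              + WeakF.nablaForm 𝒮.Φ qZ hX Y x + WeakF.nablaForm 𝒮.Φ qZ X hY x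
              - 3 * WeakF.nablaForm 𝒮.Φ qhX Y Z x
              - WeakF.nablaForm 𝒮.Φ Y hZ qX x - WeakF.nablaForm 𝒮.Φ Z qX hY x) ∧
          (X x ∈ WeakF.eigenDist h (-1) x → Z x ∈ WeakF.eigenDist h (-1) x →
            Y x ∈ WeakF.eigenDist h 1 x → WeakF.nablaForm 𝒮.Φ X Y Z x = 0) ∧
          (X x ∈ WeakF.eigenDist h 1 x → Y x ∈ WeakF.eigenDist h 1 x →
            Z x ∈ 𝒮.contact x → WeakF.nablaForm 𝒮.Φ X Y Z x = 0)) := by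
  have hg := h𝒮.compatible
  let i₀ : Fin s := ⟨0, hs⟩
  have hfin (x : M) : FiniteDimensional ℝ (TangentSpace 𝓘(ℝ, E) x) :=
    VectorBundle.finiteDimensional ℝ E (fun x : M ↦ TangentSpace 𝓘(ℝ, E) x) x
  have hS (x : M) := WeakF.FramedWeakFStructure.isSplitting h𝒮 hR hQ i₀ x
  have hT (x : M) (v : TangentSpace 𝓘(ℝ, E) x) :
      (𝒮.Q x).toLinearMap ((𝒮.ht i₀ x).toLinearMap v) =
        (𝒮.f x).toLinearMap (((𝒮.A i₀ x).toLinearMap + (𝒮.f x).toLinearMap) v) :=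
    WeakF.FramedWeakFStructure.Q_ht h𝒮 hR hQ i₀ x v
  have hrank (x : M) := (hS x).finrank_eigenspace (hT x) (𝒮.rank_f x)
  have hker (x : M) : WeakF.eigenDist (𝒮.ht i₀) 0 x = (𝒮.f x).ker := by
    ext v
    rw [WeakF.eigenDist, Module.End.mem_eigenspace_iff, zero_smul, (hS x).eq_zero_iff (hT x)]
    rfl
  have hsup (x : M) : WeakF.eigenDist (𝒮.ht i₀) 1 x ⊔ WeakF.eigenDist (𝒮.ht i₀) (-1) x =
      𝒮.contact x := by
    ext v
    rw [WeakF.FramedWeakFStructure.mem_contact_iff hg]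
    exact (hS x).eigenspace_sup (hT x) v
  have hcontact {x : M} {c : ℝ} (hc : c ≠ 0) {v : TangentSpace 𝓘(ℝ, E) x}
      (hv : v ∈ WeakF.eigenDist (𝒮.ht i₀) c x) : v ∈ 𝒮.contact x :=
    (WeakF.FramedWeakFStructure.mem_contact_iff hg).2
      (((hS x).mem_eigenspace_iff (hT x) hc).1 hv).1
  have hperp {x : M} {v w : TangentSpace 𝓘(ℝ, E) x} (hv : v ∈ (𝒮.f x).ker)
      (hw : w ∈ 𝒮.contact x) : inner ℝ v w = 0 := by
    rw [(hS x).toIsLinearWeakF.eq_sum_of_f_eq_zero hv, sum_inner]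
    refine Finset.sum_eq_zero fun i _ ↦ ?_
    rw [inner_smul_left, real_inner_comm w,
      (WeakF.FramedWeakFStructure.mem_contact_iff hg).1 hw i, mul_zero]
  have hm1 : (-1 : ℝ) ≠ 0 := by norm_num
  refine ⟨𝒮.ht i₀, fun i ↦ WeakF.FramedWeakFStructure.ht_eq h𝒮 hR hQ i i₀, fun x μ ↦ ?_, hker,
    WeakF.FramedWeakFStructure.isSmoothDistribution_ker_f h𝒮,
    WeakF.FramedWeakFStructure.isSmoothDistribution_eigenDist h𝒮 hR hQ i₀ (Or.inl rfl),
    WeakF.FramedWeakFStructure.isSmoothDistribution_eigenDist h𝒮 hR hQ i₀ (Or.inr rfl),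
    fun x ↦ ⟨?_, ?_, ?_⟩, hsup, fun x ↦ ?_, fun x ↦ ⟨?_, ?_⟩, ?_⟩
  · refine ⟨(hS x).eigenvalue (hT x), ?_⟩
    rintro (rfl | rfl | rfl)
    -- The eigenvalue 0 occurs because s > 0 provides a ξ; ±1 occur because their eigenspaces have
    -- dimension n > 0.
    · refine Module.End.hasEigenvalue_of_hasEigenvector (x := 𝒮.ξ i₀ x) ⟨?_, fun h0 ↦ ?_⟩
      · change 𝒮.ξ i₀ x ∈ WeakF.eigenDist (𝒮.ht i₀) 0 x
        rw [hker]
        exact (hS x).f_ξ i₀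
      · have := (hS x).orthonormal i₀ i₀
        simp [h0] at this
    · intro h0
      have := (hrank x).1
      change Module.End.eigenspace _ _ = ⊥ at h0
      rw [h0, finrank_bot] at this
      omega
    · intro h0
      have := (hrank x).2
      change Module.End.eigenspace _ _ = ⊥ at h0
      rw [h0, finrank_bot] at this
      omega
  · exact Submodule.isOrtho_iff_inner_eq.2 fun v hv w hw ↦ hperp hv (hcontact one_ne_zero hw)
  · exact Submodule.isOrtho_iff_inner_eq.2 fun v hv w hw ↦ hperp hv (hcontact hm1 hw)
  · exact Submodule.isOrtho_iff_inner_eq.2 fun v hv w hw ↦ (hS x).inner_eq_zero (hT x) hv hw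
  · rw [sup_assoc, hsup, eq_top_iff]
    intro v _
    obtain ⟨u, hu⟩ := (hS x).toIsLinearWeakF.exists_eq v
    rw [hu]
    refine Submodule.add_mem_sup (Submodule.sum_mem _ fun i _ ↦ Submodule.smul_mem _ _ ?_)
      ((WeakF.FramedWeakFStructure.mem_contact_iff hg).2 ((hS x).toIsLinearWeakF.inner_f_ξ u))
    exact (hS x).f_ξ i
  · exact (hS x).map_f_eq (hT x) (Or.inl rfl)
  · have := (hS x).map_f_eq (hT x) (Or.inr rfl)
    rwa [neg_neg] at this
  · intro hP X Y Z hX hY hZ x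
    have hzero {X Y Z : Π x : M, TangentSpace 𝓘(ℝ, E) x} (hY : CMDiff ∞ (T% Y))
        (hZ : CMDiff ∞ (T% Z)) (hXx : X x ∈ 𝒮.contact x) (hYx : Y x ∈ 𝒮.contact x)
        (hZx : Z x ∈ 𝒮.contact x) : WeakF.nablaForm 𝒮.Φ X Y Z x = 0 :=
      WeakF.FramedWeakFStructure.nablaForm_Φ_eq_zero h𝒮 hR hQ hs hP hY hZ hXx hYx hZx
    -- Since Q = I, each term on the right of (i) has a zero field in one slot; the left side
    -- vanishes because h̃X lies in 𝒟.
    have hqt (W : Π x : M, TangentSpace 𝓘(ℝ, E) x) : WeakF.applyEndo 𝒮.Qt W = 0 := by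
      funext y
      simp [WeakF.applyEndo, WeakF.FramedWeakFStructure.Qt,
        WeakF.FramedWeakFStructure.Q_eq_id h𝒮 hR hQ hs hP]
    have h₁ (Y Z : Π x : M, TangentSpace 𝓘(ℝ, E) x) : WeakF.nablaForm 𝒮.Φ 0 Y Z x = 0 := by
      simp [WeakF.nablaForm, WeakF.nabla, WeakF.FramedWeakFStructure.Φ]
    have h₂ (X Z : Π x : M, TangentSpace 𝓘(ℝ, E) x) : WeakF.nablaForm 𝒮.Φ X 0 Z x = 0 := by
      simp [WeakF.nablaForm, WeakF.nabla_zero, WeakF.FramedWeakFStructure.Φ, mvfderiv_const]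
    have h₃ (X Y : Π x : M, TangentSpace 𝓘(ℝ, E) x) : WeakF.nablaForm 𝒮.Φ X Y 0 x = 0 := by
      simp [WeakF.nablaForm, WeakF.nabla_zero, WeakF.FramedWeakFStructure.Φ, mvfderiv_const]
    refine ⟨fun _ hYx hZx ↦ ?_, fun hXx hZx hYx ↦ ?_, fun hXx hYx hZx ↦ ?_⟩
    · have hhX : WeakF.applyEndo (𝒮.ht i₀) X x ∈ 𝒮.contact x :=
        (WeakF.FramedWeakFStructure.mem_contact_iff hg).2 ((hS x).inner_T_ξ (hT x) (X x))
      simp only [hqt, h₁, h₂, h₃, hzero hY hZ hhX hYx hZx]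
      norm_num
    · exact hzero hY hZ (hcontact hm1 hXx) (hcontact one_ne_zero hYx) (hcontact hm1 hZx)
    · exact hzero hY hZ (hcontact one_ne_zero hXx) (hcontact one_ne_zero hYx) hZx
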